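/- \textbf{Setting.} Rules are written $a_1 \vee\cdots\vee a_n \leftarrow b_1,\dots,b_k,\ \mathrm{not}\ b_{k+1},\dots,\mathrm{not}\ b_m$ with classical literals ($a$ or $\neg a$, $a$ an atom); $H(r)$, $B^+(r)$, $B^-(r)$ are the sets of head literals, positive body literals and literals under $\mathrm{not}$. For a ground program $\Pi$ with literal base $B_\Pi$, a set $I\subseteq B_\Pi$ is an answer set if it is a minimal consistent subset of $B_\Pi$ closed under the Gelfond–Lifschitz reduct $\Pi^I$ (only consistent answer sets are considered); answer sets of a function-free program with variables are those of its ground instantiation over its constants, where $<$ is a built-in total order on constants. $\mathcal{AS}(\Pi)$ is the set of answer sets. A propositional prioritized program is a pair $\mathcal P=(P,<)$ with $P$ a finite set of propositional rules with $|H(r)|=1$ and $<$ a strict partial order on $P$ ($r'<r$: $r'$ has higher priority). Let $n=|P|$, and let $B_P$ be the set of all literals $a$, $\neg a$ over the atoms $a$ of $P$. A rule $r$ is active w.r.t. $(X,Y)$ if $B^+(r)\subseteq X$ and $B^-(r)\cap Y=\emptyset$. For $S\subseteq B_P$ put $S_0=\emptyset$, $R_0=\emptyset$, and for $1\le i\le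 n$ let $T_i$ be the set of all $r\in P$ that are active w.r.t. $(S_{i-1},S)$ and for which there is no $r'\in P$ with $r'<r$, $r'$ active w.r.t. $(S,S_{i-1})$ and $r'\notin R_{i-1}$; let $S_i=S_{i-1}\cup\bigcup_{r\in T_i}H(r)$ and $R_i=R_{i-1}\cup T_i$ (the rules used so far). Let $C^D_{\mathcal P}(S)=S_n$ if $S_n$ is consistent, and $C^D_{\mathcal P}(S)=B_P$ otherwise. The set of D-preferred answer sets is $\mathcal{DPAS}(\mathcal P)=\{A\in\mathcal{AS}(P) : C^D_{\mathcal P}(A)=A\}$. Name literals and rules of $P$ by constants, distinct literals by distinct constants and distinct rules by distinct constants. $F(\mathcal P)$ consists of the facts $rule(r)$; $head(\ell,r)$ for $\ell\in H(r)$; $pbl(\ell,r)$ for $\ell\in B^+(r)$; $nbl(\ell,r)$ for $\ell\in B^-(r)$ (for every $r\in P$); $compl(a,\neg a)$ for every atom $a$ such that $a$ and $\neg a$ both occur in $P$; and $pr(r,r')$ for every pair $r<r'$ in the transitive reduction of $<$. The program $P_{I_D}$ consists of the following rules ($\_$ is an anonymous variable): $$\begin{array}{l} lit(L)\leftarrow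 head(L,\_).\quad lit(L)\leftarrow pbl(L,\_).\quad lit(L)\leftarrow nbl(L,\_).\\ in\_S(L)\vee notin\_S(L)\leftarrow lit(L).\\ \leftarrow compl(X,Y), in\_S(X), in\_S(Y).\\ pr(X,Z)\leftarrow pr(X,Y), pr(Y,Z).\\ \leftarrow pr(X,X).\\ stage(S)\leftarrow rule(S).\\ pos\_body\_false\_S(Y)\leftarrow rule(Y), pbl(X,Y), \mathrm{not}\ in\_S(X).\\ pos\_body\_false\_Si(R,S_i)\leftarrow pbl(L,R), stage(S_i), \mathrm{not}\ in\_Si(L,S_i).\\ pos\_body\_false\_S0(R)\leftarrow pbl(L,R).\\ neg\_body\_false\_S(Y)\leftarrow rule(Y), nbl(X,Y), in\_S(X).\\ neg\_body\_false\_Si(R,S_i)\leftarrow nbl(L,R), stage(S_i), in\_Si(L,S_i).\\ active(R,S_i)\leftarrow rule(R), stage(S_i), \mathrm{not}\ pos\_body\_false\_Si(R,S_i), \mathrm{not}\ neg\_body\_false\_S(R).\\ active\_Si(R,S_i)\leftarrow rule(R), stage(S_i), \mathrm{not}\ pos\_body\_false\_S(R), \mathrm{not}\ neg\_body\_false\_Si(R,S_i).\\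 active\_S0(R)\leftarrow rule(R), \mathrm{not}\ pos\_body\_false\_S0(R), \mathrm{not}\ neg\_body\_false\_S(R).\\ rule\_not\_generating\_in\_Si(R,S_i)\leftarrow stage(S_i), head(H,R), \mathrm{not}\ in\_rule\_Si(H,R,S_i).\\ preferred\_generating\_rule\_exists(R,S_i)\leftarrow pr(R_1,R), active\_Si(R_1,S_i), rule\_not\_generating\_in\_Si(R_1,S_i).\\ preferred\_generating\_rule\_exists\_S0(R)\leftarrow pr(R_1,R), \mathrm{not}\ pos\_body\_false\_S(R_1).\\ in\_rule\_Si(H,R,S_i)\leftarrow head(H,R), active(R,S_j), stage(S_j), stage(S_i), S_i>S_j, \mathrm{not}\ preferred\_generating\_rule\_exists(R,S_j).\\ in\_rule\_Si(H,R,S_i)\leftarrow head(H,R), active\_S0(R), stage(S_i), \mathrm{not}\ preferred\_generating\_rule\_exists\_S0(R).\\ in\_Si(H,S_i)\leftarrow in\_rule\_Si(H,\_,S_i).\\ in\_PAS(L)\leftarrow in\_Si(L,\_).\\ \leftarrow in\_PAS(L), \mathrm{not}\ in\_S(L).\qquad \leftarrow in\_S(L), \mathrm{not}\ in\_PAS(L).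 \end{array}$$ Let $\pi'(A)=\{\ell : in\_PAS(\ell)\in A\}$. \textbf{Theorem.} Let $\mathcal P=(P,<)$ be a propositional prioritized program. Then (i) if $A\in\mathcal{AS}(P_{I_D}\cup F(\mathcal P))$, then $\pi'(A)\in\mathcal{DPAS}(\mathcal P)$; and (ii) for each $A\in\mathcal{DPAS}(\mathcal P)$ there is some $A'\in\mathcal{AS}(P_{I_D}\cup F(\mathcal P))$ such that $\pi'(A')=A$. -/

import Mathlib

namespace ASP

/-! ### Classical literals, rules, ground programs -/

/-- A classical literal over a set of atoms: an atom or a (strongly) negated atom. -/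
inductive Lit (A : Type*) where
  | pos (a : A) : Lit A
  | neg (a : A) : Lit A

/-- The atom of a literal. -/
def Lit.atom {A : Type*} : Lit A → A
  | .pos a => a
  | .neg a => a

/-- The complementary literal. -/
def Lit.compl {A : Type*} : Lit A → Lit A
  | .pos a => .neg a
  | .neg a => .pos a

/-- Change the atom of a literal. -/
def Lit.map {A B : Type*} (f : A → B) : Lit A → Lit B
  | .pos a => .pos (f a)
  | .neg a => .neg (f a)

/-- A rule `a₁ v ⋯ v aₙ :- b₁, …, bₖ, not bₖ₊₁, …, not bₘ` of classical literals. -/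
structure Rule (A : Type*) where
  head : List (Lit A)
  posBody : List (Lit A)
  negBody : List (Lit A)

/-- `H(r)`, the set of head literals. -/
def Rule.H {A : Type*} (r : Rule A) : Set (Lit A) := {l | l ∈ r.head}

/-- `B⁺(r)`, the set of positive body literals. -/
def Rule.Bpos {A : Type*} (r : Rule A) : Set (Lit A) := {l | l ∈ r.posBody}

/-- `B⁻(r)`, the set of literals that occur under `not` in the body. -/
def Rule.Bneg {A : Type*} (r : Rule A) : Set (Lit A) := {l | l ∈ r.negBody}

/-- The literals that occur in a rule. -/
def Rule.lits {A : Type*} (r : Rule A) : Set (Lit A) := r.H ∪ r.Bpos ∪ r.Bneg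

/-- Change the atoms of a rule. -/
def Rule.map {A B : Type*} (f : A → B) (r : Rule A) : Rule B where
  head := r.head.map (Lit.map f)
  posBody := r.posBody.map (Lit.map f)
  negBody := r.negBody.map (Lit.map f)

/-- A set of literals is consistent if it contains no complementary pair. -/
def Consistent {A : Type*} (I : Set (Lit A)) : Prop := ∀ l ∈ I, l.compl ∉ I

/-- `I` is closed under the positive ground program `Q`. -/
def ClosedUnder {A : Type*} (Q : Set (Rule A)) (I : Set (Lit A)) : Prop :=
  ∀ r ∈ Q, r.Bpos ∪ r.Bneg ⊆ I → (r.H ∩ I).Nonempty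

/-- Answer sets of a positive ground program `Q` with literal base `B`: the minimal consistent
subsets of `B` that are closed under `Q`. -/
def IsAnswerSetPos {A : Type*} (B : Set (Lit A)) (Q : Set (Rule A)) (X : Set (Lit A)) : Prop :=
  Minimal (fun Y : Set (Lit A) => Y ⊆ B ∧ Consistent Y ∧ ClosedUnder Q Y) X

/-- The Gelfond-Lifschitz reduct of a ground program. -/
def reduct {A : Type*} (Q : Set (Rule A)) (I : Set (Lit A)) : Set (Rule A) :=
  {r' | ∃ r ∈ Q, r.Bneg ∩ I = ∅ ∧ r' = ⟨r.head, r.posBody, []⟩}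

/-- The answer sets of a ground program `Q` with literal base `B`. -/
def groundAS {A : Type*} (B : Set (Lit A)) (Q : Set (Rule A)) : Set (Set (Lit A)) :=
  {I | IsAnswerSetPos B (reduct Q I) I}

/-! ### Function-free programs with variables and a built-in order -/

/-- Terms: variables and constants. -/
inductive Term (V K : Type*) where
  | var (v : V) : Term V K
  | const (c : K) : Term V K

/-- The value of a term under an assignment of constants to variables. -/
def Term.eval {V K : Type*} (s : V → K) : Term V K → K
  | .var v => s v
  | .const c => c

/-- An atom: a predicate symbol applied to a list of arguments. -/
structure PAtom (Q T : Type*) where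
  pred : Q
  args : List T

/-- The ground instance of an atom. -/
def PAtom.eval {Q V K : Type*} (s : V → K) (a : PAtom Q (Term V K)) : PAtom Q K :=
  ⟨a.pred, a.args.map (Term.eval s)⟩

/-- A rule with variables; `less` lists the built-in comparisons `t < u` of its body. -/
structure DRule (Q V K : Type*) where
  rule : Rule (PAtom Q (Term V K))
  less : List (Term V K × Term V K)

/-- The constant `c` occurs in the rule `d`. -/
def DRule.HasConst {Q V K : Type*} (d : DRule Q V K) (c : K) : Prop :=
  (∃ l ∈ d.rule.lits, Term.const c ∈ l.atom.args) ∨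
    ∃ p ∈ d.less, p.1 = Term.const c ∨ p.2 = Term.const c

/-- The constants that occur in a program. -/
def constants {Q V K : Type*} (D : Set (DRule Q V K)) : Set K := {c | ∃ d ∈ D, d.HasConst c}

/-- The Herbrand universe: the constants of the program, or one arbitrary constant if there are
none. -/
def herbrand {Q V K : Type*} [Inhabited K] (D : Set (DRule Q V K)) : Set K :=
  {c | c ∈ constants D ∨ (constants D = ∅ ∧ c = default)}

/-- All classical ground literals from the predicate symbols of the program over its Herbrand
universe. -/
def literalBase {Q V K : Type*} [Inhabited K] (D : Set (DRule Q V K)) : Set (Lit (PAtom Q K)) :=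
  {g | (∀ c ∈ g.atom.args, c ∈ herbrand D) ∧
    ∃ d ∈ D, ∃ l ∈ d.rule.lits,
      l.atom.pred = g.atom.pred ∧ l.atom.args.length = g.atom.args.length}

/-- The ground instantiation. Instances with a false built-in comparison are dropped, true built-in
comparisons are deleted. -/
def ground {Q V K : Type*} [Inhabited K] [LinearOrder K] (D : Set (DRule Q V K)) :
    Set (Rule (PAtom Q K)) :=
  {r | ∃ d ∈ D, ∃ s : V → K, (∀ v, s v ∈ herbrand D) ∧
    (∀ p ∈ d.less, p.1.eval s < p.2.eval s) ∧ r = d.rule.map (PAtom.eval s)}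

/-- The answer sets of a program with variables. -/
def AS {Q V K : Type*} [Inhabited K] [LinearOrder K] (D : Set (DRule Q V K)) :
    Set (Set (Lit (PAtom Q K))) :=
  groundAS (literalBase D) (ground D)

/-! ### Prioritized propositional programs and D-preferred answer sets -/

/-- A prioritized propositional program: a finite set of propositional rules, each with exactly one
head literal, and a strict partial order on it; `lt r s` means that `r` has higher priority. -/
structure PrioritizedProgram (α : Type*) where
  rules : Finset (Rule α)
  normal : ∀ r ∈ rules, r.H.ncard = 1
  lt : Rule α → Rule α → Prop
  lt_mem : ∀ r s, lt r s → r ∈ rules ∧ s ∈ rules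
  lt_irrefl : ∀ r, ¬ lt r r
  lt_trans : ∀ r s t, lt r s → lt s t → lt r t

namespace PrioritizedProgram

variable {α : Type*}

/-- The literals that occur in the program. -/
def lits (P : PrioritizedProgram α) : Set (Lit α) := {l | ∃ r ∈ P.rules, l ∈ r.lits}

/-- All classical literals over the atoms of the program. -/
def base (P : PrioritizedProgram α) : Set (Lit α) := {l | ∃ l' ∈ P.lits, l'.atom = l.atom}

/-- The answer sets of the program; priorities play no role. -/
def answerSets (P : PrioritizedProgram α) : Set (Set (Lit α)) :=
  groundAS P.base {r | r ∈ P.rules}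

/-- `r` is active with respect to the pair `(X, Y)`. -/
def Active (r : Rule α) (X Y : Set (Lit α)) : Prop := r.Bpos ⊆ X ∧ r.Bneg ∩ Y = ∅

/-- The rules that are applied in one step: here `X` is the set of literals derived so far, and `U`
is the set of rules that have been used to derive them. -/
def applied (P : PrioritizedProgram α) (S X : Set (Lit α)) (U : Set (Rule α)) : Set (Rule α) :=
  {r | r ∈ P.rules ∧ Active r X S ∧
    ¬ ∃ r' ∈ P.rules, P.lt r' r ∧ Active r' S X ∧ r' ∉ U}

/-- The `i`-th set `Sᵢ` of derived literals together with the set `rule(Sᵢ)` of the rules that have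
been used to derive them. -/
def stage (P : PrioritizedProgram α) (S : Set (Lit α)) : ℕ → Set (Lit α) × Set (Rule α)
  | 0 => (∅, ∅)
  | i + 1 =>
    ((P.stage S i).1 ∪ {l | ∃ r ∈ P.applied S (P.stage S i).1 (P.stage S i).2, l ∈ r.H},
      (P.stage S i).2 ∪ P.applied S (P.stage S i).1 (P.stage S i).2)

open Classical in
/-- The operator `C^D`, with `n` the number of rules. -/
noncomputable def opD (P : PrioritizedProgram α) (S : Set (Lit α)) : Set (Lit α) :=
  if Consistent (P.stage S P.rules.card).1 then (P.stage S P.rules.card).1 else P.base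

/-- The D-preferred answer sets. -/
def DPAS (P : PrioritizedProgram α) : Set (Set (Lit α)) :=
  {A | A ∈ P.answerSets ∧ P.opD A = A}

/-- The transitive reduction of the (finite) strict partial order `<`. -/
def ltRed (P : PrioritizedProgram α) (r s : Rule α) : Prop :=
  P.lt r s ∧ ¬ ∃ t, P.lt r t ∧ P.lt t s

end PrioritizedProgram

/-! ### The representation of a program by facts, and the meta-interpreter -/

/-- The predicate symbols of the meta-interpreter. -/
inductive MetaPred where
  | rule | head | pbl | nbl | compl | pr
  | lit | in_S | notin_S | stage
  | pos_body_false_S | pos_body_false_Si | pos_body_false_S0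
  | neg_body_false_S | neg_body_false_Si
  | active | active_Si | active_S0
  | rule_not_generating_in_Si
  | preferred_generating_rule_exists | preferred_generating_rule_exists_S0
  | in_rule_Si | in_Si | in_PAS

/-- The variables of the meta-interpreter; `anon` is the anonymous variable. -/
inductive MVar where
  | H | L | R | R1 | S | Si | Sj | X | Y | Z | anon

/-- The positive literal `p(c₁, …, cₙ)` with constants as arguments. -/
def cLit {K : Type*} (p : MetaPred) (cs : List K) : Lit (PAtom MetaPred (Term MVar K)) :=
  .pos ⟨p, cs.map .const⟩

/-- The positive literal `p(X₁, …, Xₙ)` with variables as arguments. -/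
def vLit {K : Type*} (p : MetaPred) (vs : List MVar) : Lit (PAtom MetaPred (Term MVar K)) :=
  .pos ⟨p, vs.map .var⟩

/-- The fact `p(c₁, …, cₙ).` -/
def fact {K : Type*} (p : MetaPred) (cs : List K) : DRule MetaPred MVar K := ⟨⟨[cLit p cs], [], []⟩, []⟩

/-- The rule whose head, positive body, negative body and built-in comparisons are given. -/
def clause {K : Type*} (hd ps ns : List (MetaPred × List MVar)) (less : List (MVar × MVar)) :
    DRule MetaPred MVar K :=
  ⟨⟨hd.map fun a => vLit a.1 a.2, ps.map fun a => vLit a.1 a.2, ns.map fun a => vLit a.1 a.2⟩,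
    less.map fun p => (.var p.1, .var p.2)⟩

/-- The facts that represent a prioritized program. The constant `nm l` names the literal `l` and
the constant `ident r` is the identifier of the rule `r`. -/
def facts {α K : Type*} (P : PrioritizedProgram α) (nm : Lit α → K) (ident : Rule α → K) :
    Set (DRule MetaPred MVar K) :=
  {d | ∃ r ∈ P.rules, d = fact .rule [ident r]} ∪
  {d | ∃ r ∈ P.rules, ∃ l ∈ r.H, d = fact .head [nm l, ident r]} ∪
  {d | ∃ r ∈ P.rules, ∃ l ∈ r.Bpos, d = fact .pbl [nm l, ident r]} ∪
  {d | ∃ r ∈ P.rules, ∃ l ∈ r.Bneg, d = fact .nbl [nm l, ident r]} ∪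
  {d | ∃ a : α, Lit.pos a ∈ P.lits ∧ Lit.neg a ∈ P.lits ∧
    d = fact .compl [nm (.pos a), nm (.neg a)]} ∪
  {d | ∃ r s, P.ltRed r s ∧ d = fact .pr [ident r, ident s]}

open MetaPred MVar in
/-- The clauses of the meta-interpreter for D-preferred answer sets. The four arguments of `clause`
are the head, the positive body, the negative body, and the built-in comparisons. -/
def metaDClauses (K : Type*) : List (DRule MetaPred MVar K) := [
  clause [(lit, [L])] [(head, [L, anon])] [] [],
  clause [(lit, [L])] [(pbl, [L, anon])] [] [],
  clause [(lit, [L])] [(nbl, [L, anon])] [] [],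
  clause [(in_S, [L]), (notin_S, [L])] [(lit, [L])] [] [],
  clause [] [(compl, [X, Y]), (in_S, [X]), (in_S, [Y])] [] [],
  clause [(pr, [X, Z])] [(pr, [X, Y]), (pr, [Y, Z])] [] [],
  clause [] [(pr, [X, X])] [] [],
  clause [(stage, [S])] [(rule, [S])] [] [],
  clause [(pos_body_false_S, [Y])] [(rule, [Y]), (pbl, [X, Y])] [(in_S, [X])] [],
  clause [(pos_body_false_Si, [R, Si])] [(pbl, [L, R]), (stage, [Si])] [(in_Si, [L, Si])] [],
  clause [(pos_body_false_S0, [R])] [(pbl, [L, R])] [] [],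
  clause [(neg_body_false_S, [Y])] [(rule, [Y]), (nbl, [X, Y]), (in_S, [X])] [] [],
  clause [(neg_body_false_Si, [R, Si])] [(nbl, [L, R]), (stage, [Si]), (in_Si, [L, Si])] [] [],
  clause [(active, [R, Si])] [(rule, [R]), (stage, [Si])]
    [(pos_body_false_Si, [R, Si]), (neg_body_false_S, [R])] [],
  clause [(active_Si, [R, Si])] [(rule, [R]), (stage, [Si])]
    [(pos_body_false_S, [R]), (neg_body_false_Si, [R, Si])] [],
  clause [(active_S0, [R])] [(rule, [R])] [(pos_body_false_S0, [R]), (neg_body_false_S, [R])] [],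
  clause [(rule_not_generating_in_Si, [R, Si])] [(stage, [Si]), (head, [H, R])]
    [(in_rule_Si, [H, R, Si])] [],
  clause [(preferred_generating_rule_exists, [R, Si])]
    [(pr, [R1, R]), (active_Si, [R1, Si]), (rule_not_generating_in_Si, [R1, Si])] [] [],
  clause [(preferred_generating_rule_exists_S0, [R])] [(pr, [R1, R])]
    [(pos_body_false_S, [R1])] [],
  clause [(in_rule_Si, [H, R, Si])]
    [(head, [H, R]), (active, [R, Sj]), (stage, [Sj]), (stage, [Si])]
    [(preferred_generating_rule_exists, [R, Sj])] [(Sj, Si)],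
  clause [(in_rule_Si, [H, R, Si])] [(head, [H, R]), (active_S0, [R]), (stage, [Si])]
    [(preferred_generating_rule_exists_S0, [R])] [],
  clause [(in_Si, [H, Si])] [(in_rule_Si, [H, anon, Si])] [] [],
  clause [(in_PAS, [L])] [(in_Si, [L, anon])] [] [],
  clause [] [(in_PAS, [L])] [(in_S, [L])] [],
  clause [] [(in_S, [L])] [(in_PAS, [L])] []]

/-- The meta-interpreter for D-preferred answer sets, as a set of rules. -/
def metaD (K : Type*) : Set (DRule MetaPred MVar K) := {d | d ∈ metaDClauses K}

/-- The projection of a set of ground literals of the meta-level to literals of the represented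
program: the literals `l` such that `in_PAS` holds of the name of `l`. -/
def projPAS {α K : Type*} (nm : Lit α → K) (A : Set (Lit (PAtom MetaPred K))) : Set (Lit α) :=
  {l | Lit.pos ⟨.in_PAS, [nm l]⟩ ∈ A}

end ASP

/-! The interpreter guesses a set `S` with its disjunctive rule and then evaluates the stage
construction for `S` deterministically. Rule identifiers double as stage names: in increasing order
they stand for the stages 1, …, n, where n is the number of rules, and the `S0` predicates treat
stage 0, which no constant names. A rule has been used by stage i exactly when it is applied at some
stage j < i (`mem_stage_snd`); this is what the two clauses for `in_rule_Si` compute. The integrity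
constraints then say that `S` is consistent and equals its n-th stage (`constraints_ext_iff`).
Nothing more has to be checked, because a consistent fixpoint of the stage construction is
automatically an answer set (`mem_DPAS_iff`).

On the side of logic programming, grounding and reducts are replaced by the one-step relation
`Derives`. Every answer set satisfies the completion (`holds_iff_derives`). Apart from the recursion
of `pr` and the mutual dependency of `in_S` and `notin_S`, all dependencies decrease in `rank`, so
the completion, together with `in_S` and `pr`, forces each predicate to have its intended extension
`Ext` (`iff_ext_of_completion`). The completion does not exclude self-supporting `pr` atoms;
minimality does (`lt_of_holds_pr`). Conversely, when `Ext` satisfies the constraints it is closed,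
and the same induction on rank shows that a subset closed under its reduct is all of it
(`ext_mem_AS`). -/

namespace ASP

/-! ### One-step derivability in the ground interpreter -/

section Interpreter

variable {α K : Type*}

/-- The atom `p(cs)` holds in a set of ground literals. -/
def Holds (A : Set (Lit (PAtom MetaPred K))) (p : MetaPred) (cs : List K) : Prop :=
  Lit.pos ⟨p, cs⟩ ∈ A

/-- One-step derivability by the meta-interpreter: positive body atoms are evaluated in `X`, atoms
under `not` in `N`. A disjunction yields a disjunct if the other one is false in `N`. -/
inductive Derives [LT K] (P : PrioritizedProgram α) (nm : Lit α → K) (ident : Rule α → K)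
    (X N : MetaPred → List K → Prop) : MetaPred → List K → Prop
  | fact {p cs} : fact p cs ∈ facts P nm ident → Derives P nm ident X N p cs
  | lit_head {l x} : X .head [l, x] → Derives P nm ident X N .lit [l]
  | lit_pbl {l x} : X .pbl [l, x] → Derives P nm ident X N .lit [l]
  | lit_nbl {l x} : X .nbl [l, x] → Derives P nm ident X N .lit [l]
  | in_S {l} : X .lit [l] → ¬ N .notin_S [l] → Derives P nm ident X N .in_S [l]
  | notin_S {l} : X .lit [l] → ¬ N .in_S [l] → Derives P nm ident X N .notin_S [l]
  | pr {x y z} : X .pr [x, y] → X .pr [y, z] → Derives P nm ident X N .pr [x, z]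
  | stage {c} : X .rule [c] → Derives P nm ident X N .stage [c]
  | pos_body_false_S {l x} : X .rule [x] → X .pbl [l, x] → ¬ N .in_S [l] →
      Derives P nm ident X N .pos_body_false_S [x]
  | pos_body_false_Si {l x c} : X .pbl [l, x] → X .stage [c] → ¬ N .in_Si [l, c] →
      Derives P nm ident X N .pos_body_false_Si [x, c]
  | pos_body_false_S0 {l x} : X .pbl [l, x] → Derives P nm ident X N .pos_body_false_S0 [x]
  | neg_body_false_S {l x} : X .rule [x] → X .nbl [l, x] → X .in_S [l] →
      Derives P nm ident X N .neg_body_false_S [x]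
  | neg_body_false_Si {l x c} : X .nbl [l, x] → X .stage [c] → X .in_Si [l, c] →
      Derives P nm ident X N .neg_body_false_Si [x, c]
  | active {x c} : X .rule [x] → X .stage [c] → ¬ N .pos_body_false_Si [x, c] →
      ¬ N .neg_body_false_S [x] → Derives P nm ident X N .active [x, c]
  | active_Si {x c} : X .rule [x] → X .stage [c] → ¬ N .pos_body_false_S [x] →
      ¬ N .neg_body_false_Si [x, c] → Derives P nm ident X N .active_Si [x, c]
  | active_S0 {x} : X .rule [x] → ¬ N .pos_body_false_S0 [x] →
      ¬ N .neg_body_false_S [x] → Derives P nm ident X N .active_S0 [x]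
  | rule_not_generating {h x c} : X .stage [c] → X .head [h, x] → ¬ N .in_rule_Si [h, x, c] →
      Derives P nm ident X N .rule_not_generating_in_Si [x, c]
  | preferred {y x c} : X .pr [y, x] → X .active_Si [y, c] →
      X .rule_not_generating_in_Si [y, c] →
      Derives P nm ident X N .preferred_generating_rule_exists [x, c]
  | preferred_S0 {y x} : X .pr [y, x] → ¬ N .pos_body_false_S [y] →
      Derives P nm ident X N .preferred_generating_rule_exists_S0 [x]
  | in_rule {h x c c'} : X .head [h, x] → X .active [x, c'] → X .stage [c'] → X .stage [c] →
      ¬ N .preferred_generating_rule_exists [x, c'] → c' < c →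
      Derives P nm ident X N .in_rule_Si [h, x, c]
  | in_rule_S0 {h x c} : X .head [h, x] → X .active_S0 [x] → X .stage [c] →
      ¬ N .preferred_generating_rule_exists_S0 [x] →
      Derives P nm ident X N .in_rule_Si [h, x, c]
  | in_Si {h x c} : X .in_rule_Si [h, x, c] → Derives P nm ident X N .in_Si [h, c]
  | in_PAS {l c} : X .in_Si [l, c] → Derives P nm ident X N .in_PAS [l]

/-- The integrity constraints of the meta-interpreter. -/
structure Constraints (T : MetaPred → List K → Prop) : Prop where
  compl : ∀ x y, T .compl [x, y] → T .in_S [x] → ¬ T .in_S [y]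
  pr : ∀ x, ¬ T .pr [x, x]
  in_S_of_in_PAS : ∀ l, T .in_PAS [l] → T .in_S [l]
  in_PAS_of_in_S : ∀ l, T .in_S [l] → T .in_PAS [l]

theorem fact_inj {p q : MetaPred} {cs ds : List K} :
    (fact p cs : DRule MetaPred MVar K) = fact q ds ↔ p = q ∧ cs = ds := by
  constructor
  · intro h
    simp only [fact, cLit, DRule.mk.injEq, Rule.mk.injEq, List.cons.injEq, Lit.pos.injEq,
      PAtom.mk.injEq] at h
    have hinj : Function.Injective (Term.const : K → Term MVar K) := by
      intro a b hab
      exact Term.const.inj hab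
    exact ⟨h.1.1.1.1, List.map_injective_iff.2 hinj h.1.1.1.2⟩
  · rintro ⟨rfl, rfl⟩
    rfl

theorem exists_eq_fact {P : PrioritizedProgram α} {nm : Lit α → K} {ident : Rule α → K}
    {d : DRule MetaPred MVar K} (hd : d ∈ facts P nm ident) :
    ∃ p cs, d = fact p cs := by
  rcases hd with ((((⟨_, _, rfl⟩ | ⟨_, _, _, _, rfl⟩) | ⟨_, _, _, _, rfl⟩) | ⟨_, _, _, _, rfl⟩) |
    ⟨_, _, _, rfl⟩) | ⟨_, _, _, rfl⟩ <;> exact ⟨_, _, rfl⟩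

theorem eval_cLit (s : MVar → K) (p : MetaPred) (cs : List K) :
    Lit.map (PAtom.eval s) (cLit p cs) = .pos ⟨p, cs⟩ := by
  simp only [cLit, Lit.map, PAtom.eval, List.map_map, Lit.pos.injEq, PAtom.mk.injEq, true_and]
  conv_rhs => rw [← List.map_id cs]
  rfl

theorem eval_vLit (s : MVar → K) (p : MetaPred) (vs : List MVar) :
    Lit.map (PAtom.eval s) (vLit p vs) = .pos ⟨p, vs.map s⟩ := by
  simp only [vLit, Lit.map, PAtom.eval, List.map_map]
  rfl

theorem map_fact_rule (s : MVar → K) (p : MetaPred) (cs : List K) :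
    (fact p cs : DRule MetaPred MVar K).rule.map (PAtom.eval s) = ⟨[.pos ⟨p, cs⟩], [], []⟩ := by
  simp [fact, Rule.map, eval_cLit]

theorem map_clause_rule (s : MVar → K) (hd ps ns : List (MetaPred × List MVar))
    (less : List (MVar × MVar)) :
    (clause hd ps ns less : DRule MetaPred MVar K).rule.map (PAtom.eval s) =
      ⟨hd.map fun a => .pos ⟨a.1, a.2.map s⟩, ps.map fun a => .pos ⟨a.1, a.2.map s⟩,
        ns.map fun a => .pos ⟨a.1, a.2.map s⟩⟩ := by
  simp only [clause, Rule.map, List.map_map]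
  congr 1 <;> exact List.map_congr_left fun a _ => eval_vLit s a.1 a.2

variable [LinearOrder K] [Inhabited K] {P : PrioritizedProgram α} {nm : Lit α → K}
  {ident : Rule α → K}

/-- A case check over the 25 clauses. The condition on the other head literals is needed only for
the guess, the one clause with two of them. -/
theorem derives_of_mem_ground {X N : Set (Lit (PAtom MetaPred K))} {r : Rule (PAtom MetaPred K)}
    (hr : r ∈ ground (metaD K ∪ facts P nm ident)) (hpos : ∀ l ∈ r.posBody, l ∈ X)
    (hneg : ∀ l ∈ r.negBody, l ∉ N) {g : Lit (PAtom MetaPred K)} (hg : g ∈ r.head)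
    (hother : ∀ g' ∈ r.head, g' ≠ g → g' ∉ N) :
    ∃ p cs, g = .pos ⟨p, cs⟩ ∧ Derives P nm ident (Holds X) (Holds N) p cs := by
  obtain ⟨d, hd, s, -, hless, rfl⟩ := hr
  rcases hd with hd | hd
  · simp only [metaD, metaDClauses, Set.mem_ofPred_eq, List.mem_cons, List.not_mem_nil,
      or_false] at hd
    rcases hd with rfl | rfl | rfl | rfl | rfl | rfl | rfl | rfl | rfl | rfl | rfl | rfl | rfl |
      rfl | rfl | rfl | rfl | rfl | rfl | rfl | rfl | rfl | rfl | rfl | rfl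
    all_goals
      simp only [map_clause_rule, List.map_cons, List.map_nil, List.mem_cons, List.not_mem_nil,
        or_false, forall_eq_or_imp, forall_eq, false_imp_iff, ne_eq] at hpos hneg hg hother
    · exact hg ▸ ⟨_, _, rfl, .lit_head hpos⟩
    · exact hg ▸ ⟨_, _, rfl, .lit_pbl hpos⟩
    · exact hg ▸ ⟨_, _, rfl, .lit_nbl hpos⟩
    · rcases hg with rfl | rfl
      · exact ⟨_, _, rfl, .in_S hpos (hother.2 (by simp))⟩
      · exact ⟨_, _, rfl, .notin_S hpos (hother.1 (by simp))⟩
    · exact hg ▸ ⟨_, _, rfl, .pr hpos.1 hpos.2⟩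
    · exact hg ▸ ⟨_, _, rfl, .stage hpos⟩
    · exact hg ▸ ⟨_, _, rfl, .pos_body_false_S hpos.1 hpos.2 hneg⟩
    · exact hg ▸ ⟨_, _, rfl, .pos_body_false_Si hpos.1 hpos.2 hneg⟩
    · exact hg ▸ ⟨_, _, rfl, .pos_body_false_S0 hpos⟩
    · exact hg ▸ ⟨_, _, rfl, .neg_body_false_S hpos.1 hpos.2.1 hpos.2.2⟩
    · exact hg ▸ ⟨_, _, rfl, .neg_body_false_Si hpos.1 hpos.2.1 hpos.2.2⟩
    · exact hg ▸ ⟨_, _, rfl, .active hpos.1 hpos.2 hneg.1 hneg.2⟩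
    · exact hg ▸ ⟨_, _, rfl, .active_Si hpos.1 hpos.2 hneg.1 hneg.2⟩
    · exact hg ▸ ⟨_, _, rfl, .active_S0 hpos hneg.1 hneg.2⟩
    · exact hg ▸ ⟨_, _, rfl, .rule_not_generating hpos.1 hpos.2 hneg⟩
    · exact hg ▸ ⟨_, _, rfl, .preferred hpos.1 hpos.2.1 hpos.2.2⟩
    · exact hg ▸ ⟨_, _, rfl, .preferred_S0 hpos hneg⟩
    · have hlt : s .Sj < s .Si := hless (.var .Sj, .var .Si) (by simp [clause])
      exact hg ▸ ⟨_, _, rfl, .in_rule hpos.1 hpos.2.1 hpos.2.2.1 hpos.2.2.2 hneg hlt⟩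
    · exact hg ▸ ⟨_, _, rfl, .in_rule_S0 hpos.1 hpos.2.1 hpos.2.2 hneg⟩
    · exact hg ▸ ⟨_, _, rfl, .in_Si hpos⟩
    · exact hg ▸ ⟨_, _, rfl, .in_PAS hpos⟩
  · obtain ⟨p, cs, rfl⟩ := exists_eq_fact hd
    rw [map_fact_rule, List.mem_singleton] at hg
    exact ⟨p, cs, hg, .fact hd⟩

/-- A set that contains what it derives and satisfies the constraints is closed. -/
theorem closedUnder_of_derives {A : Set (Lit (PAtom MetaPred K))}
    (hder : ∀ p cs, Derives P nm ident (Holds A) (Holds A) p cs → Holds A p cs)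
    (hcon : Constraints (Holds A)) :
    ClosedUnder (reduct (ground (metaD K ∪ facts P nm ident)) A) A := by
  rintro _ ⟨r, hr, hneg, rfl⟩ hbody
  have hneg' : ∀ l ∈ r.negBody, l ∉ A := fun l hl hA =>
    (Set.eq_empty_iff_forall_notMem.1 hneg) l ⟨hl, hA⟩
  have hpos : ∀ l ∈ r.posBody, l ∈ A := fun l hl => hbody (Or.inl hl)
  by_contra hempty
  have hnot : ∀ g ∈ r.head, g ∉ A := fun g hg hA => hempty ⟨g, hg, hA⟩
  -- A nonempty head would yield a derivable literal, which lies in `A`; so a violated rule can only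
  -- be an integrity constraint.
  have hnil : r.head = [] := by
    by_contra hne
    obtain ⟨g, hg⟩ := List.exists_mem_of_ne_nil _ hne
    obtain ⟨p, cs, rfl, hd⟩ := derives_of_mem_ground hr hpos hneg' hg fun g' hg' _ => hnot g' hg'
    exact hnot _ hg (hder _ _ hd)
  obtain ⟨d, hd, s, -, -, rfl⟩ := hr
  rcases hd with hd | hd
  · simp only [metaD, metaDClauses, Set.mem_ofPred_eq, List.mem_cons, List.not_mem_nil,
      or_false] at hd
    rcases hd with rfl | rfl | rfl | rfl | rfl | rfl | rfl | rfl | rfl | rfl | rfl | rfl | rfl |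
      rfl | rfl | rfl | rfl | rfl | rfl | rfl | rfl | rfl | rfl | rfl | rfl
    all_goals
      simp only [map_clause_rule, List.map_cons, List.map_nil, List.mem_cons, List.not_mem_nil,
        or_false, forall_eq_or_imp, forall_eq, reduceCtorEq] at hpos hneg' hnil
    · exact hcon.compl _ _ hpos.1 hpos.2.1 hpos.2.2
    · exact hcon.pr _ hpos
    · exact hneg' (hcon.in_S_of_in_PAS _ hpos)
    · exact hneg' (hcon.in_PAS_of_in_S _ hpos)
  · obtain ⟨p, cs, rfl⟩ := exists_eq_fact hd
    simp [map_fact_rule] at hnil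

theorem holds_args {A : Set (Lit (PAtom MetaPred K))}
    (hA : A ⊆ literalBase (metaD K ∪ facts P nm ident)) {p : MetaPred} {cs : List K}
    (h : Holds A p cs) : ∀ c ∈ cs, c ∈ herbrand (metaD K ∪ facts P nm ident) :=
  (hA h).1

/-! ### From closed sets back to derivability -/

section Closed

variable {J N : Set (Lit (PAtom MetaPred K))}

/-- Ground instances use only constants of the Herbrand universe. `hcov` guarantees this: each value
of `s` is an argument of a body atom that holds in `J`, hence lies in the universe. Variables
foreign to the clause must therefore also be sent to such values. -/
theorem exists_head_of_clause (hJ : J ⊆ literalBase (metaD K ∪ facts P nm ident))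
    (hcl : ClosedUnder (reduct (ground (metaD K ∪ facts P nm ident)) N) J)
    {hd ps ns : List (MetaPred × List MVar)} {less : List (MVar × MVar)}
    (hmem : clause hd ps ns less ∈ metaDClauses K) (s : MVar → K)
    (hcov : ∀ v, ∃ a ∈ ps, s v ∈ a.2.map s) (hless : ∀ p ∈ less, s p.1 < s p.2)
    (hps : ∀ a ∈ ps, Holds J a.1 (a.2.map s)) (hns : ∀ a ∈ ns, ¬ Holds N a.1 (a.2.map s)) :
    ∃ a ∈ hd, Holds J a.1 (a.2.map s) := by
  have hs : ∀ v, s v ∈ herbrand (metaD K ∪ facts P nm ident) := by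
    intro v
    obtain ⟨a, ha, hv⟩ := hcov v
    exact holds_args hJ (hps a ha) _ hv
  have hground : (clause hd ps ns less).rule.map (PAtom.eval s) ∈
      ground (metaD K ∪ facts P nm ident) := by
    refine ⟨_, Or.inl hmem, s, hs, ?_, rfl⟩
    intro p hp
    simp only [clause, List.mem_map] at hp
    obtain ⟨q, hq, rfl⟩ := hp
    exact hless q hq
  rw [map_clause_rule] at hground
  have hneg : (⟨hd.map fun a => .pos ⟨a.1, a.2.map s⟩, ps.map fun a => .pos ⟨a.1, a.2.map s⟩,
      ns.map fun a => .pos ⟨a.1, a.2.map s⟩⟩ : Rule (PAtom MetaPred K)).Bneg ∩ N = ∅ := by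
    refine Set.eq_empty_iff_forall_notMem.2 ?_
    rintro l ⟨hl, hlN⟩
    obtain ⟨a, ha, rfl⟩ := List.mem_map.1 hl
    exact hns a ha hlN
  obtain ⟨g, hg, hgJ⟩ := hcl _ ⟨_, hground, hneg, rfl⟩ (by
    rintro l (hl | hl)
    · obtain ⟨a, ha, rfl⟩ := List.mem_map.1 hl
      exact hps a ha
    · simp [Rule.Bneg] at hl)
  obtain ⟨a, ha, rfl⟩ := List.mem_map.1 hg
  exact ⟨a, ha, hgJ⟩

theorem constraints_of_closedUnder (hJ : J ⊆ literalBase (metaD K ∪ facts P nm ident))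
    (hcl : ClosedUnder (reduct (ground (metaD K ∪ facts P nm ident)) J) J) :
    Constraints (Holds J) where
  compl x y h1 h2 h3 := by
    have := exists_head_of_clause hJ hcl (hd := []) (ps := [(.compl, [.X, .Y]), (.in_S, [.X]),
      (.in_S, [.Y])]) (ns := []) (less := []) (by simp [metaDClauses])
      (fun | .X => x | _ => y) (by intro v; cases v <;> simp) (by simp) (by simp [*]) (by simp)
    simp at this
  pr x h := by
    have := exists_head_of_clause hJ hcl (hd := []) (ps := [(.pr, [.X, .X])]) (ns := [])
      (less := []) (by simp [metaDClauses])
      (fun _ => x) (by intro v; cases v <;> simp) (by simp) (by simp [*]) (by simp)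
    simp at this
  in_S_of_in_PAS l h := by
    by_contra hn
    have := exists_head_of_clause hJ hcl (hd := []) (ps := [(.in_PAS, [.L])])
      (ns := [(.in_S, [.L])]) (less := []) (by simp [metaDClauses])
      (fun _ => l) (by intro v; cases v <;> simp) (by simp) (by simp [*]) (by simp [*])
    simp at this
  in_PAS_of_in_S l h := by
    by_contra hn
    have := exists_head_of_clause hJ hcl (hd := []) (ps := [(.in_S, [.L])])
      (ns := [(.in_PAS, [.L])]) (less := []) (by simp [metaDClauses])
      (fun _ => l) (by intro v; cases v <;> simp) (by simp) (by simp [*]) (by simp [*])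
    simp at this

theorem herbrand_nonempty (D : Set (DRule MetaPred MVar K)) : (herbrand D).Nonempty := by
  by_cases h : constants D = ∅
  · exact ⟨default, Or.inr ⟨h, rfl⟩⟩
  · obtain ⟨c, hc⟩ := Set.nonempty_iff_ne_empty.2 h
    exact ⟨c, Or.inl hc⟩

theorem holds_of_fact
    (hcl : ClosedUnder (reduct (ground (metaD K ∪ facts P nm ident)) N) J)
    {p : MetaPred} {cs : List K} (h : fact p cs ∈ facts P nm ident) : Holds J p cs := by
  obtain ⟨c, hc⟩ := herbrand_nonempty (metaD K ∪ facts P nm ident)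
  have hground : (fact p cs).rule.map (PAtom.eval fun _ => c) ∈
      ground (metaD K ∪ facts P nm ident) :=
    -- A fact has no variables, but an instance still requires some assignment into the universe.
    ⟨_, Or.inr h, fun _ => c, fun _ => hc, by simp [fact], rfl⟩
  rw [map_fact_rule] at hground
  obtain ⟨g, hg, hgJ⟩ := hcl _ ⟨_, hground, by simp [Rule.Bneg], rfl⟩ (by
    simp [Rule.Bneg, Rule.Bpos])
  obtain rfl := List.mem_singleton.1 hg
  exact hgJ

open MetaPred MVar in
/-- A closed set contains everything it derives. -/
theorem holds_of_derives (hJN : J ⊆ N) (hJ : J ⊆ literalBase (metaD K ∪ facts P nm ident))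
    (hcl : ClosedUnder (reduct (ground (metaD K ∪ facts P nm ident)) N) J)
    {p : MetaPred} {cs : List K} (h : Derives P nm ident (Holds J) (Holds N) p cs) :
    Holds J p cs := by
  cases h with
  | fact h => exact holds_of_fact hcl h
  | @lit_head l x h =>
    simpa using exists_head_of_clause hJ hcl (hd := [(lit, [L])]) (ps := [(head, [L, anon])])
      (ns := []) (less := []) (by simp [metaDClauses]) (fun | .L => l | _ => x)
      (by intro v; cases v <;> simp) (by simp) (by simp [*]) (by simp)
  | @lit_pbl l x h =>
    simpa using exists_head_of_clause hJ hcl (hd := [(lit, [L])]) (ps := [(pbl, [L, anon])])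
      (ns := []) (less := []) (by simp [metaDClauses]) (fun | .L => l | _ => x)
      (by intro v; cases v <;> simp) (by simp) (by simp [*]) (by simp)
  | @lit_nbl l x h =>
    simpa using exists_head_of_clause hJ hcl (hd := [(lit, [L])]) (ps := [(nbl, [L, anon])])
      (ns := []) (less := []) (by simp [metaDClauses]) (fun | .L => l | _ => x)
      (by intro v; cases v <;> simp) (by simp) (by simp [*]) (by simp)
  | @in_S l h hn =>
    have := exists_head_of_clause hJ hcl (hd := [(in_S, [L]), (notin_S, [L])])
      (ps := [(lit, [L])])
      (ns := []) (less := []) (by simp [metaDClauses]) (fun _ => l)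
      (by intro v; cases v <;> simp) (by simp) (by simp [*]) (by simp)
    simp only [List.mem_cons, List.not_mem_nil, or_false, exists_eq_or_imp, exists_eq_left] at this
    -- Closure only puts one of the two disjuncts into `J`; `J ⊆ N` rules out the one that is false
    -- in `N`.
    exact this.resolve_right fun h' => hn (hJN h')
  | @notin_S l h hn =>
    have := exists_head_of_clause hJ hcl (hd := [(in_S, [L]), (notin_S, [L])])
      (ps := [(lit, [L])])
      (ns := []) (less := []) (by simp [metaDClauses]) (fun _ => l)
      (by intro v; cases v <;> simp) (by simp) (by simp [*]) (by simp)
    simp only [List.mem_cons, List.not_mem_nil, or_false, exists_eq_or_imp, exists_eq_left] at this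
    exact this.resolve_left fun h' => hn (hJN h')
  | @pr x y z h1 h2 =>
    simpa using exists_head_of_clause hJ hcl (hd := [(pr, [X, Z])])
      (ps := [(pr, [X, Y]), (pr, [Y, Z])])
      (ns := []) (less := []) (by simp [metaDClauses]) (fun | .X => x | .Y => y | _ => z)
      (by intro v; cases v <;> simp) (by simp) (by simp [*]) (by simp)
  | @stage c h =>
    simpa using exists_head_of_clause hJ hcl (hd := [(stage, [S])]) (ps := [(rule, [S])])
      (ns := []) (less := []) (by simp [metaDClauses]) (fun _ => c)
      (by intro v; cases v <;> simp) (by simp) (by simp [*]) (by simp)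
  | @pos_body_false_S l x h1 h2 h3 =>
    simpa using exists_head_of_clause hJ hcl (hd := [(pos_body_false_S, [Y])])
      (ps := [(rule, [Y]), (pbl, [X, Y])])
      (ns := [(in_S, [X])]) (less := []) (by simp [metaDClauses]) (fun | .X => l | _ => x)
      (by intro v; cases v <;> simp) (by simp) (by simp [*]) (by simp [*])
  | @pos_body_false_Si l x c h1 h2 h3 =>
    simpa using exists_head_of_clause hJ hcl (hd := [(pos_body_false_Si, [R, Si])])
      (ps := [(pbl, [L, R]), (stage, [Si])])
      (ns := [(in_Si, [L, Si])]) (less := []) (by simp [metaDClauses])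
      (fun | .L => l | .R => x | _ => c)
      (by intro v; cases v <;> simp) (by simp) (by simp [*]) (by simp [*])
  | @pos_body_false_S0 l x h =>
    simpa using exists_head_of_clause hJ hcl (hd := [(pos_body_false_S0, [R])])
      (ps := [(pbl, [L, R])])
      (ns := []) (less := []) (by simp [metaDClauses]) (fun | .L => l | _ => x)
      (by intro v; cases v <;> simp) (by simp) (by simp [*]) (by simp [*])
  | @neg_body_false_S l x h1 h2 h3 =>
    simpa using exists_head_of_clause hJ hcl (hd := [(neg_body_false_S, [Y])])
      (ps := [(rule, [Y]), (nbl, [X, Y]), (in_S, [X])])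
      (ns := []) (less := []) (by simp [metaDClauses]) (fun | .X => l | _ => x)
      (by intro v; cases v <;> simp) (by simp) (by simp [*]) (by simp [*])
  | @neg_body_false_Si l x c h1 h2 h3 =>
    simpa using exists_head_of_clause hJ hcl (hd := [(neg_body_false_Si, [R, Si])])
      (ps := [(nbl, [L, R]), (stage, [Si]), (in_Si, [L, Si])])
      (ns := []) (less := []) (by simp [metaDClauses])
      (fun | .L => l | .R => x | _ => c)
      (by intro v; cases v <;> simp) (by simp) (by simp [*]) (by simp [*])
  | @active x c h1 h2 h3 h4 =>
    simpa using exists_head_of_clause hJ hcl (hd := [(active, [R, Si])])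
      (ps := [(rule, [R]), (stage, [Si])])
      (ns := [(pos_body_false_Si, [R, Si]), (neg_body_false_S, [R])]) (less := [])
      (by simp [metaDClauses]) (fun | .R => x | _ => c)
      (by intro v; cases v <;> simp) (by simp) (by simp [*]) (by simp [*])
  | @active_Si x c h1 h2 h3 h4 =>
    simpa using exists_head_of_clause hJ hcl (hd := [(active_Si, [R, Si])])
      (ps := [(rule, [R]), (stage, [Si])])
      (ns := [(pos_body_false_S, [R]), (neg_body_false_Si, [R, Si])]) (less := [])
      (by simp [metaDClauses]) (fun | .R => x | _ => c)
      (by intro v; cases v <;> simp) (by simp) (by simp [*]) (by simp [*])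
  | @active_S0 x h1 h2 h3 =>
    simpa using exists_head_of_clause hJ hcl (hd := [(active_S0, [R])])
      (ps := [(rule, [R])])
      (ns := [(pos_body_false_S0, [R]), (neg_body_false_S, [R])]) (less := [])
      (by simp [metaDClauses]) (fun _ => x)
      (by intro v; cases v <;> simp) (by simp) (by simp [*]) (by simp [*])
  | @rule_not_generating h x c h1 h2 h3 =>
    simpa using exists_head_of_clause hJ hcl (hd := [(rule_not_generating_in_Si, [R, Si])])
      (ps := [(stage, [Si]), (head, [H, R])])
      (ns := [(in_rule_Si, [H, R, Si])]) (less := [])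
      (by simp [metaDClauses]) (fun | .R => x | .H => h | _ => c)
      (by intro v; cases v <;> simp) (by simp) (by simp [*]) (by simp [*])
  | @preferred y x c h1 h2 h3 =>
    simpa using exists_head_of_clause hJ hcl (hd := [(preferred_generating_rule_exists, [R, Si])])
      (ps := [(pr, [R1, R]), (active_Si, [R1, Si]), (rule_not_generating_in_Si, [R1, Si])])
      (ns := []) (less := [])
      (by simp [metaDClauses]) (fun | .R => x | .R1 => y | _ => c)
      (by intro v; cases v <;> simp) (by simp) (by simp [*]) (by simp [*])
  | @preferred_S0 y x h1 h2 =>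
    simpa using exists_head_of_clause hJ hcl (hd := [(preferred_generating_rule_exists_S0, [R])])
      (ps := [(pr, [R1, R])]) (ns := [(pos_body_false_S, [R1])]) (less := [])
      (by simp [metaDClauses]) (fun | .R => x | _ => y)
      (by intro v; cases v <;> simp) (by simp) (by simp [*]) (by simp [*])
  | @in_rule h x c c' h1 h2 h3 h4 h5 h6 =>
    simpa using exists_head_of_clause hJ hcl (hd := [(in_rule_Si, [H, R, Si])])
      (ps := [(head, [H, R]), (active, [R, Sj]), (stage, [Sj]), (stage, [Si])])
      (ns := [(preferred_generating_rule_exists, [R, Sj])]) (less := [(Sj, Si)])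
      (by simp [metaDClauses]) (fun | .R => x | .H => h | .Sj => c' | _ => c)
      (by intro v; cases v <;> simp) (by simp [*]) (by simp [*]) (by simp [*])
  | @in_rule_S0 h x c h1 h2 h3 h4 =>
    simpa using exists_head_of_clause hJ hcl (hd := [(in_rule_Si, [H, R, Si])])
      (ps := [(head, [H, R]), (active_S0, [R]), (stage, [Si])])
      (ns := [(preferred_generating_rule_exists_S0, [R])]) (less := [])
      (by simp [metaDClauses]) (fun | .R => x | .H => h | _ => c)
      (by intro v; cases v <;> simp) (by simp) (by simp [*]) (by simp [*])
  | @in_Si h x c h1 =>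
    simpa using exists_head_of_clause hJ hcl (hd := [(in_Si, [H, Si])])
      (ps := [(in_rule_Si, [H, anon, Si])]) (ns := []) (less := [])
      (by simp [metaDClauses]) (fun | .H => h | .Si => c | _ => x)
      (by intro v; cases v <;> simp) (by simp) (by simp [*]) (by simp [*])
  | @in_PAS l c h1 =>
    simpa using exists_head_of_clause hJ hcl (hd := [(in_PAS, [L])])
      (ps := [(in_Si, [L, anon])]) (ns := []) (less := [])
      (by simp [metaDClauses]) (fun | .L => l | _ => c)
      (by intro v; cases v <;> simp) (by simp) (by simp [*]) (by simp [*])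

end Closed

end Interpreter

end ASP

namespace ASP

/-! ### Foundedness, completion and the priority relation -/

section AnswerSets

/-- In an answer set every set `U` of its literals is founded: some literal of `U` is derived by a
rule whose positive body avoids `U`. -/
theorem exists_external_support {A : Type*} {B : Set (Lit A)} {Q : Set (Rule A)} {I : Set (Lit A)}
    (hI : I ∈ groundAS B Q) {U : Set (Lit A)} (hU : (I ∩ U).Nonempty) :
    ∃ r ∈ Q, r.Bneg ∩ I = ∅ ∧ r.Bpos ⊆ I \ U ∧ (r.H ∩ I).Nonempty ∧ r.H ∩ I ⊆ U := by
  by_contra hno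
  have hI' : IsAnswerSetPos B (reduct Q I) I := hI
  obtain ⟨⟨hB, hcons, hcl⟩, hmin⟩ := hI'
  -- Without such a rule `I \ U` would still be closed under the reduct, contradicting minimality.
  have hsub : I ≤ I \ U := by
    refine hmin ⟨Set.sdiff_subset.trans hB, ?_, ?_⟩ Set.sdiff_subset
    · exact fun l hl hl' => hcons l hl.1 hl'.1
    · rintro r' ⟨r, hr, hneg, rfl⟩ hbody
      have hne := hcl _ ⟨r, hr, hneg, rfl⟩ (hbody.trans Set.sdiff_subset)
      by_contra hempty
      refine hno ⟨r, hr, hneg, fun l hl => hbody (Or.inl hl), hne, fun l hl => ?_⟩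
      by_contra hlU
      exact hempty ⟨l, hl.1, hl.2, hlU⟩
  obtain ⟨l, hl, hlU⟩ := hU
  exact (hsub hl).2 hlU

variable {α K : Type*} [LinearOrder K] [Inhabited K] {P : PrioritizedProgram α} {nm : Lit α → K}
  {ident : Rule α → K} {A : Set (Lit (PAtom MetaPred K))}

/-- Answer sets of the interpreter satisfy its completion. -/
theorem holds_iff_derives (hA : A ∈ AS (metaD K ∪ facts P nm ident)) (p : MetaPred)
    (cs : List K) : Holds A p cs ↔ Derives P nm ident (Holds A) (Holds A) p cs := by
  have hA' : IsAnswerSetPos _ _ A := hA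
  constructor
  · intro h
    obtain ⟨r, hr, hneg, hpos, ⟨g, hgr, hgA⟩, hU⟩ :=
      -- For a singleton `U`, the supporting rule has no other head literal in `A`, as the
      -- disjunctive case of `Derives` requires.
      exists_external_support hA (U := {.pos ⟨p, cs⟩}) ⟨_, h, rfl⟩
    obtain rfl : g = .pos ⟨p, cs⟩ := hU ⟨hgr, hgA⟩
    obtain ⟨q, ds, heq, hd⟩ := derives_of_mem_ground hr (fun l hl => (hpos hl).1)
      (fun l hl hlA => (Set.eq_empty_iff_forall_notMem.1 hneg) l ⟨hl, hlA⟩) hgr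
      (fun g' hg' hne hA => hne (hU ⟨hg', hA⟩))
    cases heq
    exact hd
  · exact holds_of_derives subset_rfl hA'.1.1 hA'.1.2.2

theorem fact_pr_mem {cs : List K} (h : fact .pr cs ∈ facts P nm ident) :
    ∃ r s, P.ltRed r s ∧ cs = [ident r, ident s] := by
  simpa [facts, fact_inj] using h

/-- Induction on the number of rules strictly between `r` and `s`: an intermediate `t` splits the
interval into two that no longer contain `t`. -/
theorem transGen_ltRed {r s : Rule α} (h : P.lt r s) : Relation.TransGen P.ltRed r s := by
  classical
  induction hn : (P.rules.filter fun t => P.lt r t ∧ P.lt t s).card using Nat.strong_induction_on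
    generalizing r s with
  | _ n ih =>
    by_cases hred : P.ltRed r s
    · exact .single hred
    · obtain ⟨t, hrt, hts⟩ : ∃ t, P.lt r t ∧ P.lt t s := by
        by_contra hno
        exact hred ⟨h, hno⟩
      have ht : t ∈ P.rules.filter fun t => P.lt r t ∧ P.lt t s := by
        simp [hrt, hts, (P.lt_mem _ _ hrt).2]
      refine (ih _ ?_ hrt rfl).trans (ih _ ?_ hts rfl)
      · rw [← hn]
        refine Finset.card_lt_card ((Finset.ssubset_iff_of_subset ?_).2 ⟨t, ht, ?_⟩)
        · intro u hu
          simp only [Finset.mem_filter] at hu ⊢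
          exact ⟨hu.1, hu.2.1, P.lt_trans _ _ _ hu.2.2 hts⟩
        · simp [P.lt_irrefl]
      · rw [← hn]
        refine Finset.card_lt_card ((Finset.ssubset_iff_of_subset ?_).2 ⟨t, ht, ?_⟩)
        · intro u hu
          simp only [Finset.mem_filter] at hu ⊢
          exact ⟨hu.1, P.lt_trans _ _ _ hrt hu.2.1, hu.2.2⟩
        · simp [P.lt_irrefl]

theorem holds_pr_of_lt {T N : MetaPred → List K → Prop}
    (hT : ∀ cs, Derives P nm ident T N .pr cs → T .pr cs) {r s : Rule α} (h : P.lt r s) :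
    T .pr [ident r, ident s] := by
  have hbase : ∀ {r s : Rule α}, P.ltRed r s → T .pr [ident r, ident s] := fun h =>
    hT _ (.fact (Or.inr ⟨_, _, h, rfl⟩))
  have hgen := transGen_ltRed h
  clear h
  induction hgen with
  | single h => exact hbase h
  | tail _ h ih => exact hT _ (.pr ih (hbase h))

/-- Foundedness is applied to the set of all unintended `pr` atoms. Some member would be derived
from atoms outside this set, but facts and transitivity then yield an intended atom. Injectivity of
`ident` identifies the middle rules of two composed pairs. -/
theorem lt_of_holds_pr (hident : Set.InjOn ident {r | r ∈ P.rules})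
    (hA : A ∈ AS (metaD K ∪ facts P nm ident)) {cs : List K}
    (h : Holds A .pr cs) : ∃ r s, P.lt r s ∧ cs = [ident r, ident s] := by
  by_contra hno
  obtain ⟨r, hr, -, hpos, ⟨g, hgr, hgA⟩, hU⟩ := exists_external_support hA
    (U := {g | ∃ cs, g = .pos ⟨.pr, cs⟩ ∧ ¬ ∃ r s, P.lt r s ∧ cs = [ident r, ident s]})
    ⟨_, h, cs, rfl, hno⟩
  obtain ⟨cs', rfl, hno'⟩ := hU ⟨hgr, hgA⟩
  -- Rules for `pr` have no negative body, so negation may be evaluated in `∅`, which makes the side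
  -- conditions trivial.
  obtain ⟨q, ds, heq, hd⟩ := derives_of_mem_ground (N := ∅) hr (fun l hl => hpos hl)
    (fun l _ => id) hgr (fun _ _ _ => id)
  cases heq
  apply hno'
  have hlt : ∀ {cs}, Lit.pos ⟨.pr, cs⟩ ∈ A \ {g | ∃ cs, g = .pos ⟨.pr, cs⟩ ∧
      ¬ ∃ r s, P.lt r s ∧ cs = [ident r, ident s]} →
      ∃ r s, P.lt r s ∧ cs = [ident r, ident s] := by
    intro cs h
    by_contra hn
    exact h.2 ⟨cs, rfl, hn⟩
  cases hd with
  | fact h =>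
    obtain ⟨r, s, hrs, rfl⟩ := fact_pr_mem h
    exact ⟨r, s, hrs.1, rfl⟩
  | pr h1 h2 =>
    obtain ⟨r, s, hrs, h1⟩ := hlt h1
    obtain ⟨s', t, hst, h2⟩ := hlt h2
    simp only [List.cons.injEq, and_true] at h1 h2
    have : s = s' := hident (P.lt_mem _ _ hrs).2 (P.lt_mem _ _ hst).1 (h1.2.symm.trans h2.1)
    subst this
    exact ⟨r, t, P.lt_trans _ _ _ hrs hst, by rw [h1.1, h2.2]⟩

end AnswerSets

/-! ### Fixpoints of the stage construction -/

namespace PrioritizedProgram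

variable {α : Type*} (P : PrioritizedProgram α) (S : Set (Lit α))

theorem stage_succ_snd (i : ℕ) : (P.stage S (i + 1)).2 =
    (P.stage S i).2 ∪ P.applied S (P.stage S i).1 (P.stage S i).2 := rfl

theorem mem_stage_snd {i : ℕ} {r : Rule α} : r ∈ (P.stage S i).2 ↔
    ∃ j < i, r ∈ P.applied S (P.stage S j).1 (P.stage S j).2 := by
  induction i with
  | zero => simp [stage]
  | succ i ih => rw [stage_succ_snd, Set.mem_union, ih, Nat.exists_lt_succ_right]

theorem mem_stage_fst {i : ℕ} {l : Lit α} :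
    l ∈ (P.stage S i).1 ↔ ∃ r ∈ (P.stage S i).2, l ∈ r.H := by
  induction i with
  | zero => simp [stage]
  | succ i ih =>
    have : l ∈ (P.stage S (i + 1)).1 ↔ l ∈ (P.stage S i).1 ∨
      ∃ r ∈ P.applied S (P.stage S i).1 (P.stage S i).2, l ∈ r.H := Iff.rfl
    rw [this, ih, stage_succ_snd]
    simp only [Set.mem_union, or_and_right, exists_or]

theorem stage_snd_subset (i : ℕ) : (P.stage S i).2 ⊆ {r | r ∈ P.rules} := by
  intro r hr
  obtain ⟨_, _, hr⟩ := (P.mem_stage_snd S).1 hr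
  exact hr.1

theorem stage_snd_mono : Monotone fun i => (P.stage S i).2 := by
  intro i j hij r hr
  obtain ⟨k, hk, hr⟩ := (P.mem_stage_snd S).1 hr
  exact (P.mem_stage_snd S).2 ⟨k, hk.trans_le hij, hr⟩

theorem stage_fst_mono : Monotone fun i => (P.stage S i).1 := by
  intro i j hij l hl
  obtain ⟨r, hr, hl⟩ := (P.mem_stage_fst S).1 hl
  exact (P.mem_stage_fst S).2 ⟨r, P.stage_snd_mono S hij hr, hl⟩

theorem stage_fst_subset_lits (i : ℕ) : (P.stage S i).1 ⊆ P.lits := by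
  intro l hl
  obtain ⟨r, hr, hl⟩ := (P.mem_stage_fst S).1 hl
  exact ⟨r, P.stage_snd_subset S i hr, Or.inl (Or.inl hl)⟩

theorem stage_eq_of_snd_eq {i j : ℕ} (h : (P.stage S i).2 = (P.stage S j).2) :
    P.stage S i = P.stage S j := by
  refine Prod.ext (Set.ext fun l => ?_) h
  rw [mem_stage_fst, mem_stage_fst, h]

/-- The stages become stationary after at most as many steps as there are rules. -/
theorem stage_card_succ : P.stage S (P.rules.card + 1) = P.stage S P.rules.card := by
  obtain ⟨i, hi, heq⟩ : ∃ i ≤ P.rules.card, P.stage S (i + 1) = P.stage S i := by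
    by_contra! hno
    -- A stage is determined by its used rules, so without a repetition these would grow strictly n
    -- + 1 times inside a set of n rules.
    have hcard : ∀ i ≤ P.rules.card + 1, i ≤ (P.stage S i).2.ncard := by
      intro i
      induction i with
      | zero => simp
      | succ i ih =>
        intro hi
        have hss : (P.stage S i).2 ⊂ (P.stage S (i + 1)).2 :=
          (P.stage_snd_mono S (Nat.le_succ i)).ssubset_of_ne fun h =>
            hno i (by omega) (P.stage_eq_of_snd_eq S h.symm)
        have := Set.ncard_lt_ncard hss
          ((P.rules.finite_toSet).subset (P.stage_snd_subset S (i + 1)))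
        have := ih (by omega)
        omega
    have h1 := hcard _ le_rfl
    have h2 := Set.ncard_le_ncard (P.stage_snd_subset S (P.rules.card + 1)) P.rules.finite_toSet
    have h3 : ({r | r ∈ P.rules} : Set (Rule α)).ncard = P.rules.card :=
      Set.ncard_coe_finset P.rules
    omega
  have hstep : ∀ j k, P.stage S j = P.stage S k → P.stage S (j + 1) = P.stage S (k + 1) := by
    intro j k h
    simp only [stage, h]
  have hconst : ∀ k, P.stage S (i + k + 1) = P.stage S (i + k) := by
    intro k
    induction k with
    | zero => exact heq
    | succ k ih => exact hstep _ _ ih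
  have := hconst (P.rules.card - i)
  rwa [Nat.add_sub_cancel' hi] at this

/-- Consistent fixpoints of the stage construction are answer sets. -/
theorem mem_answerSets_of_stage_eq (hS : (P.stage S P.rules.card).1 = S) (hcons : Consistent S) :
    S ∈ P.answerSets := by
  set n := P.rules.card
  have hmem : ∀ r ∈ P.rules, r.Bneg ∩ S = ∅ → r.Bpos ⊆ S → r ∈ (P.stage S n).2 := by
    by_contra! hno
    obtain ⟨r₀, hr₀, h⟩ := hno
    let F := {r | r ∈ P.rules ∧ r.Bneg ∩ S = ∅ ∧ r.Bpos ⊆ S ∧ r ∉ (P.stage S n).2}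
    have hF : F.Finite := P.rules.finite_toSet.subset fun r hr => hr.1
    have : IsTrans (Rule α) P.lt := ⟨P.lt_trans⟩
    have : Std.Irrefl P.lt := ⟨P.lt_irrefl⟩
    have : IsStrictOrder (Rule α) P.lt := {}
    -- Take an unused applicable rule of highest priority. No unused rule above it is active with
    -- respect to `S`, so it would be applied at the stationary stage.
    obtain ⟨r, hrF, hmin⟩ := (hF.wellFoundedOn (r := P.lt)).has_min
      Set.univ ⟨⟨r₀, hr₀, h⟩, trivial⟩
    obtain ⟨r, hr, hneg, hpos, hnot⟩ := r
    apply hnot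
    have hs := congrArg Prod.snd (P.stage_card_succ S)
    rw [← hs, stage_succ_snd]
    right
    refine ⟨hr, ⟨by rwa [hS], hneg⟩, ?_⟩
    rintro ⟨r', hr', hlt, hact, hr'not⟩
    rw [hS] at hact
    exact hmin ⟨r', hr', hact.2, hact.1, hr'not⟩ trivial hlt
  have hI : IsAnswerSetPos P.base (reduct {r | r ∈ P.rules} S) S := by
    refine ⟨⟨?_, hcons, ?_⟩, ?_⟩
    · intro l hl
      rw [← hS] at hl
      exact ⟨l, P.stage_fst_subset_lits S _ hl, rfl⟩
    · rintro _ ⟨r, hr, hneg, rfl⟩ hbody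
      have hrn := hmem r hr hneg fun l hl => hbody (Or.inl hl)
      obtain ⟨l, hl⟩ := Set.nonempty_of_ncard_ne_zero
        (by rw [P.normal r hr]; exact one_ne_zero : r.H.ncard ≠ 0)
      exact ⟨l, hl, by rw [← hS]; exact (P.mem_stage_fst S).2 ⟨r, hrn, hl⟩⟩
    · rintro J ⟨-, -, hJ⟩ -
      -- Minimality: each used rule fires in `J` by induction, and its single head literal must be
      -- the one in `J`.
      have hsub : ∀ i, (P.stage S i).1 ⊆ J := by
        intro i
        induction i using Nat.strong_induction_on with
        | _ i ih =>
          intro l hl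
          obtain ⟨r, hr, hl⟩ := (P.mem_stage_fst S).1 hl
          obtain ⟨j, hj, hr⟩ := (P.mem_stage_snd S).1 hr
          obtain ⟨l', hl', hl'J⟩ := hJ _ ⟨r, hr.1, hr.2.1.2, rfl⟩ (by
            rintro m (hm | hm)
            · exact ih j hj (hr.2.1.1 hm)
            · simp [Rule.Bneg] at hm)
          obtain ⟨a, ha⟩ := Set.ncard_eq_one.1 (P.normal r hr.1)
          have hl'' : l' ∈ r.H := hl'
          rw [ha, Set.mem_singleton_iff] at hl hl''
          rw [hl, ← hl'']
          exact hl'J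
      intro l hl
      rw [← hS] at hl
      exact hsub _ hl
  exact hI

/-- The default value `P.base` of `opD` never produces a preferred answer set: if the consistent set
`S` were `P.base`, the n-th stage, being contained in it, would be consistent as well. -/
theorem mem_DPAS_iff :
    S ∈ P.DPAS ↔ Consistent S ∧ (P.stage S P.rules.card).1 = S := by
  constructor
  · rintro ⟨hans, hop⟩
    have hI : IsAnswerSetPos P.base (reduct {r | r ∈ P.rules} S) S := hans
    have hcons := hI.1.2.1
    refine ⟨hcons, ?_⟩
    unfold opD at hop
    split_ifs at hop with h
    · exact hop
    · refine absurd (fun l hl hl' => hcons l ?_ ?_) h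
      · rw [← hop]
        exact ⟨l, P.stage_fst_subset_lits S _ hl, rfl⟩
      · rw [← hop]
        exact ⟨_, P.stage_fst_subset_lits S _ hl', rfl⟩
  · rintro ⟨hcons, hS⟩
    refine ⟨P.mem_answerSets_of_stage_eq S hS hcons, ?_⟩
    unfold opD
    rw [if_pos (by rwa [hS]), hS]

end PrioritizedProgram

end ASP

namespace ASP

/-! ### Stage numbering, intended extensions and ranks -/

section Extension

variable {α K : Type*} [LinearOrder K] (P : PrioritizedProgram α) (nm : Lit α → K)
  (ident : Rule α → K) (S : Set (Lit α))

/-- The position of the constant `c` among the rule identifiers. -/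
def stageIndex (c : K) : ℕ := (P.rules.filter fun r => ident r ≤ c).card

theorem stageIndex_le_card (c : K) : stageIndex P ident c ≤ P.rules.card :=
  Finset.card_filter_le _ _

theorem stageIndex_mono : Monotone (stageIndex P ident) := by
  intro c d hcd
  refine Finset.card_le_card fun r hr => ?_
  simp only [Finset.mem_filter] at hr ⊢
  exact ⟨hr.1, hr.2.trans hcd⟩

theorem stageIndex_lt {c : K} {q : Rule α} (hq : q ∈ P.rules) (h : c < ident q) :
    stageIndex P ident c < stageIndex P ident (ident q) := by
  refine Finset.card_lt_card ((Finset.ssubset_iff_of_subset fun r hr => ?_).2 ⟨q, ?_, ?_⟩)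
  · simp only [Finset.mem_filter] at hr ⊢
    exact ⟨hr.1, hr.2.trans h.le⟩
  · simp [hq]
  · simp [h]

theorem stageIndex_pos {q : Rule α} (hq : q ∈ P.rules) : 0 < stageIndex P ident (ident q) :=
  Finset.card_pos.2 ⟨q, by simp [hq]⟩

/-- Identifiers are distinct, so their positions map n rules injectively into {1, …, n}, hence onto
it. -/
theorem exists_stageIndex_eq (hident : Set.InjOn ident {r | r ∈ P.rules}) {j : ℕ} (hj : 0 < j)
    (hj' : j ≤ P.rules.card) : ∃ q ∈ P.rules, stageIndex P ident (ident q) = j := by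
  have := Finset.surj_on_of_inj_on_of_card_le (s := P.rules) (t := Finset.Icc 1 P.rules.card)
    (fun q _ => stageIndex P ident (ident q))
    (fun q hq => Finset.mem_Icc.2 ⟨stageIndex_pos P ident hq, stageIndex_le_card P ident _⟩)
    (fun q q' hq hq' h => by
      by_contra hne
      rcases lt_or_gt_of_ne (fun h => hne (hident hq hq' h)) with hlt | hlt
      · exact (stageIndex_lt P ident hq' hlt).ne h
      · exact (stageIndex_lt P ident hq hlt).ne' h)
    (by simp) j (Finset.mem_Icc.2 ⟨hj, hj'⟩)
  obtain ⟨q, hq, h⟩ := this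
  exact ⟨q, hq, h.symm⟩

/-- The intended extension of each predicate of the interpreter when `in_S` represents `S`. -/
def Ext : MetaPred → List K → Prop
  | .rule, [x] => ∃ r ∈ P.rules, ident r = x
  | .head, [h, x] => ∃ r ∈ P.rules, ident r = x ∧ ∃ l ∈ r.H, nm l = h
  | .pbl, [h, x] => ∃ r ∈ P.rules, ident r = x ∧ ∃ l ∈ r.Bpos, nm l = h
  | .nbl, [h, x] => ∃ r ∈ P.rules, ident r = x ∧ ∃ l ∈ r.Bneg, nm l = h
  | .compl, [x, y] => ∃ a, .pos a ∈ P.lits ∧ .neg a ∈ P.lits ∧ nm (.pos a) = x ∧ nm (.neg a) = y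
  | .pr, [x, y] => ∃ r s, P.lt r s ∧ ident r = x ∧ ident s = y
  | .lit, [h] => ∃ l ∈ P.lits, nm l = h
  | .in_S, [h] => ∃ l ∈ S, nm l = h
  | .notin_S, [h] => ∃ l ∈ P.lits, l ∉ S ∧ nm l = h
  | .stage, [c] => ∃ q ∈ P.rules, ident q = c
  | .pos_body_false_S, [x] => ∃ r ∈ P.rules, ident r = x ∧ ¬ r.Bpos ⊆ S
  | .pos_body_false_Si, [x, c] => (∃ q ∈ P.rules, ident q = c) ∧
      ∃ r ∈ P.rules, ident r = x ∧ ¬ r.Bpos ⊆ (P.stage S (stageIndex P ident c)).1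
  | .pos_body_false_S0, [x] => ∃ r ∈ P.rules, ident r = x ∧ ¬ r.Bpos ⊆ ∅
  | .neg_body_false_S, [x] => ∃ r ∈ P.rules, ident r = x ∧ ¬ r.Bneg ∩ S = ∅
  | .neg_body_false_Si, [x, c] => (∃ q ∈ P.rules, ident q = c) ∧
      ∃ r ∈ P.rules, ident r = x ∧ ¬ r.Bneg ∩ (P.stage S (stageIndex P ident c)).1 = ∅
  | .active, [x, c] => (∃ q ∈ P.rules, ident q = c) ∧
      ∃ r ∈ P.rules, ident r = x ∧
        PrioritizedProgram.Active r (P.stage S (stageIndex P ident c)).1 S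
  | .active_Si, [x, c] => (∃ q ∈ P.rules, ident q = c) ∧
      ∃ r ∈ P.rules, ident r = x ∧
        PrioritizedProgram.Active r S (P.stage S (stageIndex P ident c)).1
  | .active_S0, [x] => ∃ r ∈ P.rules, ident r = x ∧ PrioritizedProgram.Active r ∅ S
  | .rule_not_generating_in_Si, [x, c] => (∃ q ∈ P.rules, ident q = c) ∧
      ∃ r ∈ P.rules, ident r = x ∧ r ∉ (P.stage S (stageIndex P ident c)).2
  | .preferred_generating_rule_exists, [x, c] => (∃ q ∈ P.rules, ident q = c) ∧
      ∃ r ∈ P.rules, ident r = x ∧ ∃ r' ∈ P.rules, P.lt r' r ∧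
        PrioritizedProgram.Active r' S (P.stage S (stageIndex P ident c)).1 ∧
        r' ∉ (P.stage S (stageIndex P ident c)).2
  | .preferred_generating_rule_exists_S0, [x] =>
      ∃ r ∈ P.rules, ident r = x ∧ ∃ r' ∈ P.rules, P.lt r' r ∧ r'.Bpos ⊆ S
  | .in_rule_Si, [h, x, c] => (∃ q ∈ P.rules, ident q = c) ∧
      ∃ r ∈ P.rules, ident r = x ∧ r ∈ (P.stage S (stageIndex P ident c)).2 ∧ ∃ l ∈ r.H, nm l = h
  | .in_Si, [h, c] => (∃ q ∈ P.rules, ident q = c) ∧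
      ∃ l ∈ (P.stage S (stageIndex P ident c)).1, nm l = h
  | .in_PAS, [h] => ∃ l ∈ (P.stage S P.rules.card).1, nm l = h
  | _, _ => False

variable {P nm ident S}

theorem exists_ident_iff (hident : Set.InjOn ident {r | r ∈ P.rules}) {r : Rule α}
    (hr : r ∈ P.rules) {p : Rule α → Prop} :
    (∃ r' ∈ P.rules, ident r' = ident r ∧ p r') ↔ p r := by
  constructor
  · rintro ⟨r', hr', h, hp⟩
    rwa [← hident hr' hr h]
  · exact fun h => ⟨r, hr, rfl, h⟩

theorem ext_of_fact {cs : List K} {p : MetaPred} (h : fact p cs ∈ facts P nm ident) :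
    Ext P nm ident S p cs := by
  rcases h with ((((⟨r, hr, h⟩ | ⟨r, hr, l, hl, h⟩) | ⟨r, hr, l, hl, h⟩) | ⟨r, hr, l, hl, h⟩) |
    ⟨a, h1, h2, h⟩) | ⟨r, s, hrs, h⟩ <;> obtain ⟨rfl, rfl⟩ := fact_inj.1 h
  · exact ⟨r, hr, rfl⟩
  · exact ⟨r, hr, rfl, l, hl, rfl⟩
  · exact ⟨r, hr, rfl, l, hl, rfl⟩
  · exact ⟨r, hr, rfl, l, hl, rfl⟩
  · exact ⟨a, h1, h2, rfl, rfl⟩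
  · exact ⟨r, s, hrs.1, rfl, rfl⟩

/-- Injectivity of `nm` matters where two literal occurrences share a name, and that of `ident`
where two rule occurrences do. -/
theorem ext_of_derives (hnm : Function.Injective nm) (hident : Set.InjOn ident {r | r ∈ P.rules})
    {p : MetaPred} {cs : List K}
    (h : Derives P nm ident (Ext P nm ident S) (Ext P nm ident S) p cs) :
    Ext P nm ident S p cs := by
  cases h with
  | fact h => exact ext_of_fact h
  | lit_head h =>
    obtain ⟨r, hr, rfl, l, hl, rfl⟩ := h
    exact ⟨l, ⟨r, hr, Or.inl (Or.inl hl)⟩, rfl⟩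
  | lit_pbl h =>
    obtain ⟨r, hr, rfl, l, hl, rfl⟩ := h
    exact ⟨l, ⟨r, hr, Or.inl (Or.inr hl)⟩, rfl⟩
  | lit_nbl h =>
    obtain ⟨r, hr, rfl, l, hl, rfl⟩ := h
    exact ⟨l, ⟨r, hr, Or.inr hl⟩, rfl⟩
  | in_S h hn =>
    obtain ⟨l, hl, rfl⟩ := h
    exact ⟨l, by_contra fun hS => hn ⟨l, hl, hS, rfl⟩, rfl⟩
  | notin_S h hn =>
    obtain ⟨l, hl, rfl⟩ := h
    exact ⟨l, hl, fun hS => hn ⟨l, hS, rfl⟩, rfl⟩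
  | pr h1 h2 =>
    obtain ⟨r, s, hrs, rfl, rfl⟩ := h1
    obtain ⟨s', t, hst, hs, rfl⟩ := h2
    obtain rfl := hident (P.lt_mem _ _ hst).1 (P.lt_mem _ _ hrs).2 hs
    exact ⟨r, t, P.lt_trans _ _ _ hrs hst, rfl, rfl⟩
  | stage h => exact h
  | pos_body_false_S _ h1 h2 =>
    obtain ⟨r, hr, rfl, l, hl, rfl⟩ := h1
    exact ⟨r, hr, rfl, fun h => h2 ⟨l, h hl, rfl⟩⟩
  | pos_body_false_Si h1 hc h2 =>
    obtain ⟨r, hr, rfl, l, hl, rfl⟩ := h1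
    exact ⟨hc, r, hr, rfl, fun h => h2 ⟨hc, l, h hl, rfl⟩⟩
  | pos_body_false_S0 h1 =>
    obtain ⟨r, hr, rfl, l, hl, rfl⟩ := h1
    exact ⟨r, hr, rfl, fun h => h hl⟩
  | neg_body_false_S _ h1 h2 =>
    obtain ⟨r, hr, rfl, l, hl, rfl⟩ := h1
    obtain ⟨l', hl', h⟩ := h2
    obtain rfl := hnm h
    exact ⟨r, hr, rfl, fun h => (Set.eq_empty_iff_forall_notMem.1 h) _ ⟨hl, hl'⟩⟩
  | neg_body_false_Si h1 hc h2 =>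
    obtain ⟨r, hr, rfl, l, hl, rfl⟩ := h1
    obtain ⟨-, l', hl', h⟩ := h2
    obtain rfl := hnm h
    exact ⟨hc, r, hr, rfl, fun h => (Set.eq_empty_iff_forall_notMem.1 h) _ ⟨hl, hl'⟩⟩
  | active h1 hc h2 h3 =>
    obtain ⟨r, hr, rfl⟩ := h1
    exact ⟨hc, r, hr, rfl, by_contra fun h => h2 ⟨hc, r, hr, rfl, h⟩,
      by_contra fun h => h3 ⟨r, hr, rfl, h⟩⟩
  | active_Si h1 hc h2 h3 =>
    obtain ⟨r, hr, rfl⟩ := h1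
    exact ⟨hc, r, hr, rfl, by_contra fun h => h2 ⟨r, hr, rfl, h⟩,
      by_contra fun h => h3 ⟨hc, r, hr, rfl, h⟩⟩
  | active_S0 h1 h2 h3 =>
    obtain ⟨r, hr, rfl⟩ := h1
    exact ⟨r, hr, rfl, by_contra fun h => h2 ⟨r, hr, rfl, h⟩,
      by_contra fun h => h3 ⟨r, hr, rfl, h⟩⟩
  | rule_not_generating hc h1 h2 =>
    obtain ⟨r, hr, rfl, l, hl, rfl⟩ := h1
    exact ⟨hc, r, hr, rfl, fun h => h2 ⟨hc, r, hr, rfl, h, l, hl, rfl⟩⟩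
  | preferred h1 h2 h3 =>
    obtain ⟨r', r, hlt, rfl, rfl⟩ := h1
    obtain ⟨hr', hr⟩ := P.lt_mem _ _ hlt
    obtain ⟨hc, h2⟩ := h2
    exact ⟨hc, r, hr, rfl, r', hr', hlt, (exists_ident_iff hident hr').1 h2,
      (exists_ident_iff hident hr').1 h3.2⟩
  | preferred_S0 h1 h2 =>
    obtain ⟨r', r, hlt, rfl, rfl⟩ := h1
    obtain ⟨hr', hr⟩ := P.lt_mem _ _ hlt
    exact ⟨r, hr, rfl, r', hr', hlt, by_contra fun h => h2 ⟨r', hr', rfl, h⟩⟩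
  | in_rule h1 h2 hc' hc h3 hlt =>
    obtain ⟨r, hr, rfl, l, hl, rfl⟩ := h1
    obtain ⟨q, hq, rfl⟩ := hc
    refine ⟨⟨q, hq, rfl⟩, r, hr, rfl, ?_, l, hl, rfl⟩
    refine (P.mem_stage_snd S).2 ⟨_, stageIndex_lt P ident hq hlt, hr,
      (exists_ident_iff hident hr).1 h2.2, ?_⟩
    rintro ⟨r', hr', h⟩
    exact h3 ⟨hc', r, hr, rfl, r', hr', h⟩
  | in_rule_S0 h1 h2 hc h3 =>
    obtain ⟨r, hr, rfl, l, hl, rfl⟩ := h1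
    obtain ⟨q, hq, rfl⟩ := hc
    refine ⟨⟨q, hq, rfl⟩, r, hr, rfl, ?_, l, hl, rfl⟩
    refine (P.mem_stage_snd S).2 ⟨_, stageIndex_pos P ident hq, hr,
      (exists_ident_iff hident hr).1 h2, ?_⟩
    rintro ⟨r', hr', h⟩
    -- At stage 0 nothing is derived or used, so of the blocking condition only the positive body
    -- remains.
    exact h3 ⟨r, hr, rfl, r', hr', h.1, h.2.1.1⟩
  | in_Si h =>
    obtain ⟨hc, r, hr, rfl, hrc, l, hl, rfl⟩ := h
    exact ⟨hc, l, (P.mem_stage_fst S).2 ⟨r, hrc, hl⟩, rfl⟩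
  | in_PAS h =>
    obtain ⟨hc, l, hl, rfl⟩ := h
    exact ⟨l, P.stage_fst_mono S (stageIndex_le_card P ident _) hl, rfl⟩

/-- Extensions other than that of `pr` are derived in one step. -/
theorem derives_of_ext (hnm : Function.Injective nm) (hident : Set.InjOn ident {r | r ∈ P.rules})
    (hS : S ⊆ P.lits) {p : MetaPred} {cs : List K} (hp : p ≠ .pr) (h : Ext P nm ident S p cs) :
    Derives P nm ident (Ext P nm ident S) (Ext P nm ident S) p cs := by
  have hlit : ∀ {l}, l ∈ P.lits → Ext P nm ident S .lit [nm l] := fun hl => ⟨_, hl, rfl⟩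
  have hnempos : ∀ {r : Rule α}, ∀ {X : Set (Lit α)}, ¬ r.Bpos ⊆ X → ∃ l ∈ r.Bpos, l ∉ X :=
    fun h => Set.not_subset.1 h
  have hnemneg : ∀ {r : Rule α}, ∀ {X : Set (Lit α)}, ¬ r.Bneg ∩ X = ∅ →
      ∃ l ∈ r.Bneg, l ∈ X := fun h => Set.nonempty_iff_ne_empty.2 h
  unfold Ext at h
  split at h
  · obtain ⟨r, hr, rfl⟩ := h
    exact .fact (by simp only [facts, Set.mem_union, Set.mem_ofPred_eq]; grind)
  · obtain ⟨r, hr, rfl, l, hl, rfl⟩ := h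
    exact .fact (by simp only [facts, Set.mem_union, Set.mem_ofPred_eq]; grind)
  · obtain ⟨r, hr, rfl, l, hl, rfl⟩ := h
    exact .fact (by simp only [facts, Set.mem_union, Set.mem_ofPred_eq]; grind)
  · obtain ⟨r, hr, rfl, l, hl, rfl⟩ := h
    exact .fact (by simp only [facts, Set.mem_union, Set.mem_ofPred_eq]; grind)
  · obtain ⟨a, h1, h2, rfl, rfl⟩ := h
    exact .fact (by simp only [facts, Set.mem_union, Set.mem_ofPred_eq]; grind)
  · exact absurd rfl hp
  · obtain ⟨l, ⟨r, hr, (hl | hl) | hl⟩, rfl⟩ := h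
    · exact .lit_head (x := ident r) ⟨r, hr, rfl, l, hl, rfl⟩
    · exact .lit_pbl (x := ident r) ⟨r, hr, rfl, l, hl, rfl⟩
    · exact .lit_nbl (x := ident r) ⟨r, hr, rfl, l, hl, rfl⟩
  · obtain ⟨l, hl, rfl⟩ := h
    refine .in_S (hlit (hS hl)) ?_
    rintro ⟨l', -, hn, heq⟩
    exact hn (hnm heq ▸ hl)
  · obtain ⟨l, hl, hn, rfl⟩ := h
    refine .notin_S (hlit hl) ?_
    rintro ⟨l', hl', heq⟩
    exact hn (hnm heq ▸ hl')
  · exact .stage h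
  · obtain ⟨r, hr, rfl, hn⟩ := h
    obtain ⟨l, hl, hlS⟩ := hnempos hn
    refine .pos_body_false_S (l := nm l) ⟨r, hr, rfl⟩ ⟨r, hr, rfl, l, hl, rfl⟩ ?_
    rintro ⟨l', hl', heq⟩
    exact hlS (hnm heq ▸ hl')
  · obtain ⟨hc, r, hr, rfl, hn⟩ := h
    obtain ⟨l, hl, hlS⟩ := hnempos hn
    refine .pos_body_false_Si (l := nm l) ⟨r, hr, rfl, l, hl, rfl⟩ hc ?_
    rintro ⟨-, l', hl', heq⟩
    exact hlS (hnm heq ▸ hl')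
  · obtain ⟨r, hr, rfl, hn⟩ := h
    obtain ⟨l, hl, hlS⟩ := hnempos hn
    exact .pos_body_false_S0 (l := nm l) ⟨r, hr, rfl, l, hl, rfl⟩
  · obtain ⟨r, hr, rfl, hn⟩ := h
    obtain ⟨l, hl, hlS⟩ := hnemneg hn
    exact .neg_body_false_S (l := nm l) ⟨r, hr, rfl⟩ ⟨r, hr, rfl, l, hl, rfl⟩ ⟨l, hlS, rfl⟩
  · obtain ⟨hc, r, hr, rfl, hn⟩ := h
    obtain ⟨l, hl, hlS⟩ := hnemneg hn
    exact .neg_body_false_Si (l := nm l) ⟨r, hr, rfl, l, hl, rfl⟩ hc ⟨hc, l, hlS, rfl⟩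
  · obtain ⟨hc, r, hr, rfl, hact⟩ := h
    exact .active ⟨r, hr, rfl⟩ hc (fun h => (exists_ident_iff hident hr).1 h.2 hact.1)
      (fun h => (exists_ident_iff hident hr).1 h hact.2)
  · obtain ⟨hc, r, hr, rfl, hact⟩ := h
    exact .active_Si ⟨r, hr, rfl⟩ hc (fun h => (exists_ident_iff hident hr).1 h hact.1)
      (fun h => (exists_ident_iff hident hr).1 h.2 hact.2)
  · obtain ⟨r, hr, rfl, hact⟩ := h
    exact .active_S0 ⟨r, hr, rfl⟩ (fun h => (exists_ident_iff hident hr).1 h hact.1)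
      (fun h => (exists_ident_iff hident hr).1 h hact.2)
  · obtain ⟨hc, r, hr, rfl, hn⟩ := h
    -- A rule without head literals could never be reported as not generating.
    obtain ⟨l, hl⟩ := Set.nonempty_of_ncard_ne_zero
      (by rw [P.normal r hr]; exact one_ne_zero : r.H.ncard ≠ 0)
    exact .rule_not_generating (h := nm l) hc ⟨r, hr, rfl, l, hl, rfl⟩
      fun h => hn ((exists_ident_iff hident hr).1 h.2).1
  · obtain ⟨hc, r, hr, rfl, r', hr', hlt, hact, hn⟩ := h
    exact .preferred (y := ident r') ⟨r', r, hlt, rfl, rfl⟩ ⟨hc, r', hr', rfl, hact⟩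
      ⟨hc, r', hr', rfl, hn⟩
  · obtain ⟨r, hr, rfl, r', hr', hlt, hpos⟩ := h
    exact .preferred_S0 (y := ident r') ⟨r', r, hlt, rfl, rfl⟩
      fun h => (exists_ident_iff hident hr').1 h hpos
  · obtain ⟨hc, r, hr, rfl, hrc, l, hl, rfl⟩ := h
    obtain ⟨j, hj, -, hact, hpref⟩ := (P.mem_stage_snd S).1 hrc
    -- The rule was applied at an earlier stage `j`: stage 0 belongs to the `S0` clause, and a
    -- positive `j` is the position of some identifier.
    rcases Nat.eq_zero_or_pos j with rfl | hpos
    · refine .in_rule_S0 ⟨r, hr, rfl, l, hl, rfl⟩ ⟨r, hr, rfl, hact⟩ hc fun h => hpref ?_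
      obtain ⟨r', hr', hlt, hpos⟩ := (exists_ident_iff hident hr).1 h
      exact ⟨r', hr', hlt, ⟨hpos, Set.inter_empty _⟩, fun h => h⟩
    · obtain ⟨q, hq, rfl⟩ := exists_stageIndex_eq P ident hident hpos
        (hj.le.trans (stageIndex_le_card P ident _))
      exact .in_rule (c' := ident q) ⟨r, hr, rfl, l, hl, rfl⟩ ⟨⟨q, hq, rfl⟩, r, hr, rfl, hact⟩
        ⟨q, hq, rfl⟩ hc (fun h => hpref ((exists_ident_iff hident hr).1 h.2))
        ((stageIndex_mono P ident).reflect_lt hj)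
  · obtain ⟨hc, l, hl, rfl⟩ := h
    obtain ⟨r, hrc, hl⟩ := (P.mem_stage_fst S).1 hl
    have hr := P.stage_snd_subset S _ hrc
    exact .in_Si (x := ident r) ⟨hc, r, hr, rfl, hrc, l, hl, rfl⟩
  · obtain ⟨l, hl, rfl⟩ := h
    obtain ⟨r, hr, -⟩ := P.stage_fst_subset_lits S _ hl
    -- The greatest identifier names stage n; it exists because a derived literal comes from some
    -- rule.
    obtain ⟨q, hq, hqn⟩ := exists_stageIndex_eq P ident hident
      (Finset.card_pos.2 ⟨r, hr⟩) le_rfl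
    exact .in_PAS (c := ident q) ⟨⟨q, hq, rfl⟩, l, by rwa [hqn], rfl⟩
  · exact h.elim

/-- A rank of ground atoms that decreases along dependencies of the interpreter, except for the
recursion of `pr` and the guess of `in_S`. -/
def rank (P : PrioritizedProgram α) (ident : Rule α → K) : MetaPred → List K → ℕ
  | .lit, _ => 1
  | .stage, _ => 1
  | .in_S, _ => 2
  | .notin_S, _ => 3
  | .pos_body_false_S, _ => 4
  | .pos_body_false_S0, _ => 4
  | .neg_body_false_S, _ => 4
  | .active_S0, _ => 5
  | .preferred_generating_rule_exists_S0, _ => 5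
  | .in_rule_Si, [_, _, c] => 20 * stageIndex P ident c + 6
  | .in_Si, [_, c] => 20 * stageIndex P ident c + 7
  | .pos_body_false_Si, [_, c] => 20 * stageIndex P ident c + 8
  | .neg_body_false_Si, [_, c] => 20 * stageIndex P ident c + 8
  | .active, [_, c] => 20 * stageIndex P ident c + 9
  | .active_Si, [_, c] => 20 * stageIndex P ident c + 9
  | .rule_not_generating_in_Si, [_, c] => 20 * stageIndex P ident c + 9
  | .preferred_generating_rule_exists, [_, c] => 20 * stageIndex P ident c + 10
  | .in_PAS, _ => 20 * P.rules.card + 20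
  | _, _ => 0

/-- Allows `X` and `N` to be exchanged when they agree suitably below the rank of the derived atom.
Within one stage the offsets run from 6 to 10, so a step of 20 puts all of stage `c'` below
`in_rule_Si` at a later stage `c`. The disjunct `p = .in_S` covers its negative dependency on
`notin_S`, which has larger rank. -/
theorem Derives.mono_of_rank {X X' N N' : MetaPred → List K → Prop} {p : MetaPred} {cs : List K}
    (hp : p ≠ .pr) (hstage : ∀ c, X .stage [c] → ∃ q ∈ P.rules, ident q = c)
    (hX : ∀ q ds, rank P ident q ds < rank P ident p cs → X q ds → X' q ds)
    (hN : ∀ q ds, p = .in_S ∨ rank P ident q ds < rank P ident p cs → N' q ds → N q ds)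
    (h : Derives P nm ident X N p cs) : Derives P nm ident X' N' p cs := by
  cases h with
  | fact h => exact .fact h
  | lit_head h => exact .lit_head (hX _ _ (by simp [rank]) h)
  | lit_pbl h => exact .lit_pbl (hX _ _ (by simp [rank]) h)
  | lit_nbl h => exact .lit_nbl (hX _ _ (by simp [rank]) h)
  | in_S h hn => exact .in_S (hX _ _ (by simp [rank]) h) (mt (hN _ _ (Or.inl rfl)) hn)
  | notin_S h hn =>
    exact .notin_S (hX _ _ (by simp [rank]) h) (mt (hN _ _ (Or.inr (by simp [rank]))) hn)
  | pr => exact absurd rfl hp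
  | stage h => exact .stage (hX _ _ (by simp [rank]) h)
  | pos_body_false_S h1 h2 h3 =>
    exact .pos_body_false_S (hX _ _ (by simp [rank]) h1) (hX _ _ (by simp [rank]) h2)
      (mt (hN _ _ (Or.inr (by simp [rank]))) h3)
  | pos_body_false_Si h1 h2 h3 =>
    exact .pos_body_false_Si (hX _ _ (by simp [rank]) h1) (hX _ _ (by simp [rank]) h2)
      (mt (hN _ _ (Or.inr (by simp [rank]))) h3)
  | pos_body_false_S0 h1 => exact .pos_body_false_S0 (hX _ _ (by simp [rank]) h1)
  | neg_body_false_S h1 h2 h3 =>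
    exact .neg_body_false_S (hX _ _ (by simp [rank]) h1) (hX _ _ (by simp [rank]) h2)
      (hX _ _ (by simp [rank]) h3)
  | neg_body_false_Si h1 h2 h3 =>
    exact .neg_body_false_Si (hX _ _ (by simp [rank]) h1) (hX _ _ (by simp [rank]) h2)
      (hX _ _ (by simp [rank]) h3)
  | active h1 h2 h3 h4 =>
    exact .active (hX _ _ (by simp [rank]) h1) (hX _ _ (by simp [rank]) h2)
      (mt (hN _ _ (Or.inr (by simp [rank]))) h3)
      (mt (hN _ _ (Or.inr (by simp only [rank]; omega))) h4)
  | active_Si h1 h2 h3 h4 =>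
    exact .active_Si (hX _ _ (by simp [rank]) h1) (hX _ _ (by simp [rank]) h2)
      (mt (hN _ _ (Or.inr (by simp only [rank]; omega))) h3)
      (mt (hN _ _ (Or.inr (by simp [rank]))) h4)
  | active_S0 h1 h2 h3 =>
    exact .active_S0 (hX _ _ (by simp [rank]) h1) (mt (hN _ _ (Or.inr (by simp [rank]))) h2)
      (mt (hN _ _ (Or.inr (by simp [rank]))) h3)
  | rule_not_generating h1 h2 h3 =>
    exact .rule_not_generating (hX _ _ (by simp [rank]) h1) (hX _ _ (by simp [rank]) h2)
      (mt (hN _ _ (Or.inr (by simp [rank]))) h3)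
  | preferred h1 h2 h3 =>
    exact .preferred (hX _ _ (by simp [rank]) h1) (hX _ _ (by simp [rank]) h2)
      (hX _ _ (by simp [rank]) h3)
  | preferred_S0 h1 h2 =>
    exact .preferred_S0 (hX _ _ (by simp [rank]) h1) (mt (hN _ _ (Or.inr (by simp [rank]))) h2)
  | in_rule h1 h2 h3 h4 h5 hlt =>
    -- `stageIndex` increases strictly only when the larger constant is an identifier.
    obtain ⟨q, hq, rfl⟩ := hstage _ h4
    have := stageIndex_lt P ident hq hlt
    exact .in_rule (hX _ _ (by simp [rank]) h1) (hX _ _ (by simp only [rank]; omega) h2)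
      (hX _ _ (by simp [rank]) h3) (hX _ _ (by simp [rank]) h4)
      (mt (hN _ _ (Or.inr (by simp only [rank]; omega))) h5) hlt
  | in_rule_S0 h1 h2 h3 h4 =>
    exact .in_rule_S0 (hX _ _ (by simp [rank]) h1) (hX _ _ (by simp only [rank]; omega) h2)
      (hX _ _ (by simp [rank]) h3) (mt (hN _ _ (Or.inr (by simp only [rank]; omega))) h4)
  | in_Si h => exact .in_Si (hX _ _ (by simp [rank]) h)
  | @in_PAS l c h =>
    have := stageIndex_le_card P ident c
    exact .in_PAS (hX _ _ (by simp only [rank]; omega) h)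

end Extension

end ASP

namespace ASP

/-! ### Answer sets of the interpreter and preferred answer sets -/

section Correspondence

variable {α K : Type*} [LinearOrder K] {P : PrioritizedProgram α} {nm : Lit α → K}
  {ident : Rule α → K} {S : Set (Lit α)}

/-- The completion of the interpreter determines all predicates from `in_S` and `pr`. -/
theorem iff_ext_of_completion (hnm : Function.Injective nm)
    (hident : Set.InjOn ident {r | r ∈ P.rules}) (hS : S ⊆ P.lits)
    {T : MetaPred → List K → Prop} (hT : ∀ p cs, T p cs ↔ Derives P nm ident T T p cs)
    (hin : ∀ cs, T .in_S cs ↔ Ext P nm ident S .in_S cs)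
    (hpr : ∀ cs, T .pr cs ↔ Ext P nm ident S .pr cs)
    (hstage : ∀ c, T .stage [c] → ∃ q ∈ P.rules, ident q = c) (p : MetaPred) (cs : List K) :
    T p cs ↔ Ext P nm ident S p cs := by
  induction hn : rank P ident p cs using Nat.strong_induction_on generalizing p cs with
  | _ n ih =>
    subst hn
    by_cases hp : p = .pr
    · exact hp ▸ hpr cs
    by_cases hi : p = .in_S
    · exact hi ▸ hin cs
    constructor
    · intro h
      exact ext_of_derives hnm hident (((hT p cs).1 h).mono_of_rank hp hstage
        (fun q ds hlt => (ih _ hlt q ds rfl).1)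
        (fun q ds hlt => (ih _ (hlt.resolve_left hi) q ds rfl).2))
    · intro h
      exact (hT p cs).2 ((derives_of_ext hnm hident hS hp h).mono_of_rank hp (fun _ h => h)
        (fun q ds hlt => (ih _ hlt q ds rfl).2)
        (fun q ds hlt => (ih _ (hlt.resolve_left hi) q ds rfl).1))

/-- Facts for `compl` exist only for atoms both of whose literals occur in the program; `S ⊆ P.lits`
makes them sufficient for consistency. The constraint on `pr` holds by irreflexivity. -/
theorem constraints_ext_iff (hnm : Function.Injective nm)
    (hident : Set.InjOn ident {r | r ∈ P.rules}) (hS : S ⊆ P.lits) :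
    Constraints (Ext P nm ident S) ↔ Consistent S ∧ (P.stage S P.rules.card).1 = S := by
  constructor
  · intro h
    refine ⟨?_, Set.Subset.antisymm ?_ ?_⟩
    · rintro (a | a) ha ha'
      · exact h.compl _ _ ⟨a, hS ha, hS ha', rfl, rfl⟩ ⟨_, ha, rfl⟩ ⟨_, ha', rfl⟩
      · exact h.compl _ _ ⟨a, hS ha', hS ha, rfl, rfl⟩ ⟨_, ha', rfl⟩ ⟨_, ha, rfl⟩
    · intro l hl
      obtain ⟨l', hl', heq⟩ := h.in_S_of_in_PAS (nm l) ⟨l, hl, rfl⟩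
      exact hnm heq ▸ hl'
    · intro l hl
      obtain ⟨l', hl', heq⟩ := h.in_PAS_of_in_S (nm l) ⟨l, hl, rfl⟩
      exact hnm heq ▸ hl'
  · rintro ⟨hcons, hfix⟩
    refine ⟨?_, ?_, ?_, ?_⟩
    · rintro _ _ ⟨a, -, -, rfl, rfl⟩ ⟨l, hl, h⟩ ⟨l', hl', h'⟩
      obtain rfl := hnm h
      obtain rfl := hnm h'
      exact hcons _ hl hl'
    · rintro _ ⟨r, s, hlt, rfl, h⟩
      obtain rfl := hident (P.lt_mem _ _ hlt).2 (P.lt_mem _ _ hlt).1 h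
      exact P.lt_irrefl _ hlt
    · rintro _ ⟨l, hl, rfl⟩
      exact ⟨l, hfix ▸ hl, rfl⟩
    · rintro _ ⟨l, hl, rfl⟩
      exact ⟨l, by rwa [hfix], rfl⟩

variable [Inhabited K]

theorem projPAS_mem_DPAS (hnm : Function.Injective nm)
    (hident : Set.InjOn ident {r | r ∈ P.rules}) {A : Set (Lit (PAtom MetaPred K))}
    (hA : A ∈ AS (metaD K ∪ facts P nm ident)) : projPAS nm A ∈ P.DPAS := by
  have hA' : IsAnswerSetPos _ _ A := hA
  have hT := holds_iff_derives hA
  let S : Set (Lit α) := {l | l ∈ P.lits ∧ Holds A .in_S [nm l]}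
  have hS : S ⊆ P.lits := fun l hl => hl.1
  have hrule : ∀ {cs}, Holds A .rule cs → Ext P nm ident S .rule cs := fun h => by
    cases (hT _ _).1 h with
    | fact h => exact ext_of_fact h
  have hlit : ∀ {l}, Holds A .lit [l] → ∃ l' ∈ P.lits, nm l' = l := fun h => by
    cases (hT _ _).1 h with
    | fact h => exact ext_of_fact (S := S) h
    | lit_head h =>
      cases (hT _ _).1 h with
      | fact h =>
        obtain ⟨r, hr, -, l, hl, rfl⟩ := ext_of_fact (S := S) h
        exact ⟨l, ⟨r, hr, Or.inl (Or.inl hl)⟩, rfl⟩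
    | lit_pbl h =>
      cases (hT _ _).1 h with
      | fact h =>
        obtain ⟨r, hr, -, l, hl, rfl⟩ := ext_of_fact (S := S) h
        exact ⟨l, ⟨r, hr, Or.inl (Or.inr hl)⟩, rfl⟩
    | lit_nbl h =>
      cases (hT _ _).1 h with
      | fact h =>
        obtain ⟨r, hr, -, l, hl, rfl⟩ := ext_of_fact (S := S) h
        exact ⟨l, ⟨r, hr, Or.inr hl⟩, rfl⟩
  have hin : ∀ cs, Holds A .in_S cs ↔ Ext P nm ident S .in_S cs := by
    intro cs
    constructor
    · intro h
      cases (hT _ _).1 h with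
      | fact h => exact ext_of_fact h
      | in_S hl _ =>
        obtain ⟨l, hlP, rfl⟩ := hlit hl
        exact ⟨l, ⟨hlP, h⟩, rfl⟩
    · intro h
      unfold Ext at h
      split at h <;> try contradiction
      obtain ⟨l, hl, rfl⟩ := h
      exact hl.2
  have hpr : ∀ cs, Holds A .pr cs ↔ Ext P nm ident S .pr cs := by
    intro cs
    constructor
    · intro h
      obtain ⟨r, s, hrs, rfl⟩ := lt_of_holds_pr hident hA h
      exact ⟨r, s, hrs, rfl, rfl⟩
    · intro h
      unfold Ext at h
      split at h <;> try contradiction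
      obtain ⟨r, s, hrs, rfl, rfl⟩ := h
      exact holds_pr_of_lt (fun cs => (hT _ cs).2) hrs
  have hstage : ∀ c, Holds A .stage [c] → ∃ q ∈ P.rules, ident q = c := fun c h => by
    cases (hT _ _).1 h with
    | fact h => exact ext_of_fact (S := S) h
    | stage h => exact hrule h
  -- With `in_S` and `pr` identified, the completion determines the entire answer set.
  have hext : Holds A = Ext P nm ident S := by
    funext p cs
    exact propext (iff_ext_of_completion hnm hident hS hT hin hpr hstage p cs)
  have hcon := constraints_of_closedUnder hA'.1.1 hA'.1.2.2
  rw [hext, constraints_ext_iff hnm hident hS] at hcon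
  have hproj : projPAS nm A = S := by
    ext l
    change Holds A .in_PAS [nm l] ↔ _
    rw [hext]
    constructor
    · rintro ⟨l', hl', heq⟩
      rw [hcon.2] at hl'
      exact hnm heq ▸ hl'
    · intro hl
      exact ⟨l, by rwa [hcon.2], rfl⟩
  rw [hproj]
  exact (P.mem_DPAS_iff S).2 hcon

/-- The number of arguments of a predicate of the interpreter. -/
def MetaPred.arity : MetaPred → ℕ
  | .rule | .lit | .in_S | .notin_S | .stage | .pos_body_false_S | .pos_body_false_S0
  | .neg_body_false_S | .active_S0 | .preferred_generating_rule_exists_S0 | .in_PAS => 1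
  | .in_rule_Si => 3
  | _ => 2

/-- The literal base admits only predicate symbols that occur with the right arity; all of them
already occur in the clauses, whatever the facts are. -/
theorem exists_mem_metaD (p : MetaPred) : ∃ d ∈ metaD K, ∃ l ∈ d.rule.lits,
    l.atom.pred = p ∧ l.atom.args.length = p.arity := by
  have key : ∀ i, ∀ hi : i < (metaDClauses K).length, ∀ l ∈ ((metaDClauses K)[i]).rule.lits,
      ∃ d ∈ metaD K, ∃ l' ∈ d.rule.lits,
        l'.atom.pred = l.atom.pred ∧ l'.atom.args.length = l.atom.args.length :=
    fun i hi l hl => ⟨_, List.getElem_mem hi, l, hl, rfl, rfl⟩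
  have hlen : (metaDClauses K).length = 25 := rfl
  cases p with
  | rule => exact key 7 (by omega) _ (Or.inl (Or.inr (.head _)))
  | head => exact key 0 (by omega) _ (Or.inl (Or.inr (.head _)))
  | pbl => exact key 1 (by omega) _ (Or.inl (Or.inr (.head _)))
  | nbl => exact key 2 (by omega) _ (Or.inl (Or.inr (.head _)))
  | compl => exact key 4 (by omega) _ (Or.inl (Or.inr (.head _)))
  | pr => exact key 5 (by omega) _ (Or.inl (Or.inl (.head _)))
  | lit => exact key 0 (by omega) _ (Or.inl (Or.inl (.head _)))
  | in_S => exact key 3 (by omega) _ (Or.inl (Or.inl (.head _)))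
  | notin_S => exact key 3 (by omega) _ (Or.inl (Or.inl (.tail _ (.head _))))
  | stage => exact key 7 (by omega) _ (Or.inl (Or.inl (.head _)))
  | pos_body_false_S => exact key 8 (by omega) _ (Or.inl (Or.inl (.head _)))
  | pos_body_false_Si => exact key 9 (by omega) _ (Or.inl (Or.inl (.head _)))
  | pos_body_false_S0 => exact key 10 (by omega) _ (Or.inl (Or.inl (.head _)))
  | neg_body_false_S => exact key 11 (by omega) _ (Or.inl (Or.inl (.head _)))
  | neg_body_false_Si => exact key 12 (by omega) _ (Or.inl (Or.inl (.head _)))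
  | active => exact key 13 (by omega) _ (Or.inl (Or.inl (.head _)))
  | active_Si => exact key 14 (by omega) _ (Or.inl (Or.inl (.head _)))
  | active_S0 => exact key 15 (by omega) _ (Or.inl (Or.inl (.head _)))
  | rule_not_generating_in_Si => exact key 16 (by omega) _ (Or.inl (Or.inl (.head _)))
  | preferred_generating_rule_exists => exact key 17 (by omega) _ (Or.inl (Or.inl (.head _)))
  | preferred_generating_rule_exists_S0 => exact key 18 (by omega) _ (Or.inl (Or.inl (.head _)))
  | in_rule_Si => exact key 19 (by omega) _ (Or.inl (Or.inl (.head _)))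
  | in_Si => exact key 21 (by omega) _ (Or.inl (Or.inl (.head _)))
  | in_PAS => exact key 22 (by omega) _ (Or.inl (Or.inl (.head _)))

theorem ext_length {p : MetaPred} {cs : List K} (h : Ext P nm ident S p cs) :
    cs.length = p.arity := by
  unfold Ext at h
  split at h <;> first | rfl | exact h.elim

theorem ident_mem_herbrand {r : Rule α} (hr : r ∈ P.rules) :
    ident r ∈ herbrand (metaD K ∪ facts P nm ident) := by
  refine Or.inl ⟨fact .rule [ident r], Or.inr ?_, Or.inl ⟨cLit .rule [ident r], ?_, ?_⟩⟩
  · simp only [facts, Set.mem_union, Set.mem_ofPred_eq]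
    grind
  · simp [fact, Rule.lits, Rule.H]
  · simp [cLit, Lit.atom]

theorem nm_mem_herbrand {l : Lit α} (hl : l ∈ P.lits) :
    nm l ∈ herbrand (metaD K ∪ facts P nm ident) := by
  have key : ∀ {p x}, fact p [nm l, x] ∈ facts P nm ident →
      nm l ∈ herbrand (metaD K ∪ facts P nm ident) := by
    intro p x h
    refine Or.inl ⟨_, Or.inr h, Or.inl ⟨cLit p [nm l, x], ?_, ?_⟩⟩
    · simp [fact, Rule.lits, Rule.H]
    · simp [cLit, Lit.atom]
  obtain ⟨r, hr, (hl | hl) | hl⟩ := hl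
  · refine key (p := .head) (x := ident r) ?_
    simp only [facts, Set.mem_union, Set.mem_ofPred_eq]
    grind
  · refine key (p := .pbl) (x := ident r) ?_
    simp only [facts, Set.mem_union, Set.mem_ofPred_eq]
    grind
  · refine key (p := .nbl) (x := ident r) ?_
    simp only [facts, Set.mem_union, Set.mem_ofPred_eq]
    grind

theorem ext_args (hS : S ⊆ P.lits) {p : MetaPred} {cs : List K} (h : Ext P nm ident S p cs) :
    ∀ c ∈ cs, c ∈ herbrand (metaD K ∪ facts P nm ident) := by
  have hr : ∀ {r}, r ∈ P.rules → ident r ∈ herbrand (metaD K ∪ facts P nm ident) :=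
    ident_mem_herbrand
  have hl : ∀ {l}, l ∈ P.lits → nm l ∈ herbrand (metaD K ∪ facts P nm ident) :=
    nm_mem_herbrand
  have hH : ∀ {r l}, r ∈ P.rules → l ∈ r.H → l ∈ P.lits :=
    fun hr hl => ⟨_, hr, Or.inl (Or.inl hl)⟩
  have hB : ∀ {r l}, r ∈ P.rules → l ∈ r.Bpos → l ∈ P.lits :=
    fun hr hl => ⟨_, hr, Or.inl (Or.inr hl)⟩
  have hN : ∀ {r l}, r ∈ P.rules → l ∈ r.Bneg → l ∈ P.lits := fun hr hl => ⟨_, hr, Or.inr hl⟩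
  have hlt := P.lt_mem
  have hst : ∀ {i l}, l ∈ (P.stage S i).1 → l ∈ P.lits := fun h => P.stage_fst_subset_lits S _ h
  unfold Ext at h
  split at h <;> first | exact h.elim | skip
  all_goals
    simp only [List.mem_cons, List.not_mem_nil, or_false, forall_eq_or_imp, forall_eq]
    grind

theorem ext_mem_AS (hnm : Function.Injective nm) (hident : Set.InjOn ident {r | r ∈ P.rules})
    (hS : S ⊆ P.lits) (hcon : Constraints (Ext P nm ident S)) :
    {g | ∃ p cs, g = .pos ⟨p, cs⟩ ∧ Ext P nm ident S p cs} ∈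
      AS (metaD K ∪ facts P nm ident) := by
  set A : Set (Lit (PAtom MetaPred K)) :=
    {g | ∃ p cs, g = .pos ⟨p, cs⟩ ∧ Ext P nm ident S p cs} with hAdef
  have hext : Holds A = Ext P nm ident S := by
    funext p cs
    refine propext ⟨?_, fun h => ⟨p, cs, rfl, h⟩⟩
    rintro ⟨q, ds, heq, h⟩
    cases heq
    exact h
  have hA : IsAnswerSetPos (literalBase (metaD K ∪ facts P nm ident))
      (reduct (ground (metaD K ∪ facts P nm ident)) A) A := by
    refine ⟨⟨?_, ?_, ?_⟩, ?_⟩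
    · rintro _ ⟨p, cs, rfl, h⟩
      obtain ⟨d, hd, l, hl, hp, hlen⟩ := exists_mem_metaD (K := K) p
      exact ⟨ext_args hS h, d, Or.inl hd, l, hl, hp, hlen.trans (ext_length h).symm⟩
    · rintro _ ⟨p, cs, rfl, -⟩ ⟨q, ds, h, -⟩
      cases h
    · refine closedUnder_of_derives ?_ (hext ▸ hcon)
      rw [hext]
      exact fun p cs => ext_of_derives hnm hident
    · rintro J ⟨hJB, -, hJ⟩ hJA
      -- The reduct fixes negation at the candidate set, so only positive atoms are evaluated in
      -- `J`.
      have hder : ∀ {p cs}, Derives P nm ident (Holds J) (Ext P nm ident S) p cs →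
          Holds J p cs := fun h => holds_of_derives hJA hJB hJ (hext ▸ h)
      have hmain : ∀ p cs, Ext P nm ident S p cs → Holds J p cs := by
        intro p cs h
        induction hn : rank P ident p cs using Nat.strong_induction_on generalizing p cs with
        | _ n ih =>
          subst hn
          by_cases hp : p = .pr
          · subst hp
            unfold Ext at h
            split at h <;> try contradiction
            obtain ⟨r, s, hrs, rfl, rfl⟩ := h
            -- The recursion of `pr` is not ranked, but its intended atoms follow from the facts by
            -- transitivity alone.
            exact holds_pr_of_lt (fun cs => hder) hrs
          · exact hder ((derives_of_ext hnm hident hS hp h).mono_of_rank hp (fun _ h => h)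
              (fun q ds hlt h => ih _ hlt q ds h rfl) (fun _ _ _ h => h))
      rintro _ ⟨p, cs, rfl, h⟩
      exact hmain p cs h
  exact hA

end Correspondence

end ASP

theorem theorem6 {α K : Type*} [LinearOrder K] [Inhabited K]
    (P : ASP.PrioritizedProgram α)
    (nm : ASP.Lit α → K) (hnm : Function.Injective nm)
    (ident : ASP.Rule α → K) (hident : Set.InjOn ident {r | r ∈ P.rules}) :
    (∀ A ∈ ASP.AS (ASP.metaD K ∪ ASP.facts P nm ident), ASP.projPAS nm A ∈ P.DPAS) ∧
    (∀ A ∈ P.DPAS, ∃ A' ∈ ASP.AS (ASP.metaD K ∪ ASP.facts P nm ident),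
      ASP.projPAS nm A' = A) := by
  refine ⟨fun A hA => ASP.projPAS_mem_DPAS hnm hident hA, fun S hSD => ?_⟩
  have h := (P.mem_DPAS_iff S).1 hSD
  have hS : S ⊆ P.lits := h.2 ▸ P.stage_fst_subset_lits S _
  refine ⟨_, ASP.ext_mem_AS hnm hident hS ((ASP.constraints_ext_iff hnm hident hS).2 h), ?_⟩
  ext l
  constructor
  · rintro ⟨p, cs, heq, hE⟩
    cases heq
    obtain ⟨l', hl', heq⟩ := hE
    rw [h.2] at hl'
    exact hnm heq ▸ hl'
  · intro hl
    exact ⟨_, _, rfl, l, by rwa [h.2], rfl⟩
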